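/- Let $\Omega\subset\mathbb{R}^d$ be a bounded Lipschitz domain, i.e. a bounded connected nonempty open set such that every $x\in\partial\Omega$ is the centre of a ball $B$ for which, after a rigid motion, $\Omega\cap B=\{y\in B: y_d<\lambda(y_1,\dots,y_{d-1})\}$ with a Lipschitz continuous function $\lambda$. Let $\varphi:\mathbb{R}^d\to\mathbb{R}$ be an $\mathcal N$-function, i.e. $\varphi$ is continuous, convex and even, $\varphi(\xi)=0$ if and only if $\xi=0$, $\lim_{|\xi|\to\infty}\varphi(\xi)/|\xi|=\infty$ and $\lim_{|\xi|\to0}\varphi(\xi)/|\xi|=0$. Let the Orlicz space $L_\varphi(\Omega)^d$ be the linear hull of the set of all measurable $\xi:\Omega\to\mathbb{R}^d$ with $\int_\Omega\varphi(\xi(x))\,dx<\infty$, equipped with the Luxemburg norm $$\|\xi\|_{\varphi,\Omega}=\inf\Big\{\lambda>0:\int_\Omega\varphi\big(\xi(x)/\lambda\big)\,dx\le1\Big\},$$ and let $E_\varphi(\Omega)^d$ be the closure in $L_\varphi(\Omega)^d$, with respect to this norm, of the set of bounded measurable functions. Let $C_c^\infty(\Omega)$ be the set of real-valued infinitely differentiable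 functions with compact support in $\Omega$, let $H^1(\Omega)$ be the set of all $w\in L^2(\Omega)$ whose weak gradient exists and lies in $L^2(\Omega)^d$, let $H^1_0(\Omega)$ be the closure of $C_c^\infty(\Omega)$ in $H^1(\Omega)$ with respect to the $H^1$-norm, and let $$V=\{w\in H^1_0(\Omega):\nabla w\in E_\varphi(\Omega)^d\},\qquad \|w\|_V=\|\nabla w\|_{L^2(\Omega)^d}+\|\nabla w\|_{\varphi,\Omega}.$$ Then $C_c^\infty(\Omega)$ is dense in $V$: $C_c^\infty(\Omega)\subset V$, and for every $w\in V$ and every $\varepsilon>0$ there is $\psi\in C_c^\infty(\Omega)$ with $\|w-\psi\|_V<\varepsilon$. -/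

import Mathlib

open MeasureTheory Filter Topology TopologicalSpace
open scoped ENNReal NNReal Distributions RealInnerProductSpace

/-- An `N`-function of a vector-valued (possibly anisotropic) argument. -/
structure IsNFunction {d : ℕ} (φ : EuclideanSpace ℝ (Fin d) → ℝ) : Prop where
  continuous : Continuous φ
  eq_zero_iff : ∀ ξ, φ ξ = 0 ↔ ξ = 0
  even : ∀ ξ, φ (-ξ) = φ ξ
  convex : ConvexOn ℝ Set.univ φ
  superlinear_infty : Tendsto (fun ξ => φ ξ / ‖ξ‖) (Bornology.cobounded _) atTop
  superlinear_zero : Tendsto (fun ξ => φ ξ / ‖ξ‖) (𝓝[≠] 0) (𝓝 0)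

/-- A bounded Lipschitz domain: a bounded, connected open set which near every boundary point is,
after a rigid motion, the part of a ball strictly below the graph of a Lipschitz function. The
rotated last coordinate direction is the unit vector `e`, and the Lipschitz function depends on the
component of `y` in the hyperplane orthogonal to `e`. -/
structure IsBoundedLipschitzDomain {d : ℕ} (Ω : Opens (EuclideanSpace ℝ (Fin d))) : Prop where
  isBounded : Bornology.IsBounded (Ω : Set (EuclideanSpace ℝ (Fin d)))
  isConnected : IsConnected (Ω : Set (EuclideanSpace ℝ (Fin d)))
  lipschitz_boundary : ∀ x ∈ frontier (Ω : Set (EuclideanSpace ℝ (Fin d))),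
    ∃ r : ℝ, 0 < r ∧ ∃ e : EuclideanSpace ℝ (Fin d), ‖e‖ = 1 ∧
      ∃ (K : ℝ≥0) (lam : (Submodule.span ℝ {e})ᗮ → ℝ), LipschitzWith K lam ∧
        (Ω : Set (EuclideanSpace ℝ (Fin d))) ∩ Metric.ball x r =
          {y | y ∈ Metric.ball x r ∧
            ⟪e, y⟫ < lam ((Submodule.span ℝ {e})ᗮ.orthogonalProjectionOnto y)}

noncomputable section

/-- The modular `∫_Ω φ(ξ(x)) dx`, with values in `[0, ∞]`. -/
def orliczModular {d : ℕ} (φ : EuclideanSpace ℝ (Fin d) → ℝ)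
    (Ω : Opens (EuclideanSpace ℝ (Fin d)))
    (ξ : EuclideanSpace ℝ (Fin d) → EuclideanSpace ℝ (Fin d)) : ℝ≥0∞ :=
  ∫⁻ x in (Ω : Set (EuclideanSpace ℝ (Fin d))), ENNReal.ofReal (φ (ξ x))

/-- The Orlicz class: measurable functions with finite modular. -/
def orliczClass {d : ℕ} (φ : EuclideanSpace ℝ (Fin d) → ℝ)
    (Ω : Opens (EuclideanSpace ℝ (Fin d))) :
    Set (EuclideanSpace ℝ (Fin d) → EuclideanSpace ℝ (Fin d)) :=
  {ξ | AEStronglyMeasurable ξ (volume.restrict (Ω : Set (EuclideanSpace ℝ (Fin d)))) ∧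
    orliczModular φ Ω ξ < ⊤}

/-- The Orlicz space `L_φ(Ω)^d`: the linear hull of the Orlicz class. -/
def orliczSpace {d : ℕ} (φ : EuclideanSpace ℝ (Fin d) → ℝ)
    (Ω : Opens (EuclideanSpace ℝ (Fin d))) :
    Submodule ℝ (EuclideanSpace ℝ (Fin d) → EuclideanSpace ℝ (Fin d)) :=
  Submodule.span ℝ (orliczClass φ Ω)

/-- The Luxemburg norm, with value `∞` if no admissible `l` exists. -/
def luxemburgNorm {d : ℕ} (φ : EuclideanSpace ℝ (Fin d) → ℝ)
    (Ω : Opens (EuclideanSpace ℝ (Fin d)))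
    (ξ : EuclideanSpace ℝ (Fin d) → EuclideanSpace ℝ (Fin d)) : ℝ≥0∞ :=
  sInf {t | ∃ l : ℝ, 0 < l ∧ orliczModular φ Ω (fun x => l⁻¹ • ξ x) ≤ 1 ∧ t = ENNReal.ofReal l}

/-- The space `E_φ(Ω)^d`: the closure in the Orlicz space, with respect to the Luxemburg norm, of
the bounded measurable functions. -/
def orliczE {d : ℕ} (φ : EuclideanSpace ℝ (Fin d) → ℝ)
    (Ω : Opens (EuclideanSpace ℝ (Fin d))) :
    Set (EuclideanSpace ℝ (Fin d) → EuclideanSpace ℝ (Fin d)) :=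
  {ξ | ξ ∈ orliczSpace φ Ω ∧ ∀ ε : ℝ, 0 < ε →
    ∃ b : EuclideanSpace ℝ (Fin d) → EuclideanSpace ℝ (Fin d), Measurable b ∧
      (∃ C : ℝ, ∀ x, ‖b x‖ ≤ C) ∧ luxemburgNorm φ Ω (ξ - b) < ENNReal.ofReal ε}

/-- `G` is a weak gradient of `w` on `Ω`. -/
def IsWeakGradient {d : ℕ} (Ω : Opens (EuclideanSpace ℝ (Fin d)))
    (w : EuclideanSpace ℝ (Fin d) → ℝ)
    (G : EuclideanSpace ℝ (Fin d) → EuclideanSpace ℝ (Fin d)) : Prop :=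
  LocallyIntegrableOn w (Ω : Set (EuclideanSpace ℝ (Fin d))) ∧
  LocallyIntegrableOn G (Ω : Set (EuclideanSpace ℝ (Fin d))) ∧
  ∀ ψ : 𝓓(Ω, ℝ),
    ∫ x in (Ω : Set (EuclideanSpace ℝ (Fin d))), w x • gradient ψ x =
      - ∫ x in (Ω : Set (EuclideanSpace ℝ (Fin d))), ψ x • G x

open Classical in
/-- The weak gradient of `w` on `Ω` (unique up to equality a.e. in `Ω`), and `0` if there is
none. -/
def weakGradient {d : ℕ} (Ω : Opens (EuclideanSpace ℝ (Fin d)))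
    (w : EuclideanSpace ℝ (Fin d) → ℝ) :
    EuclideanSpace ℝ (Fin d) → EuclideanSpace ℝ (Fin d) :=
  if h : ∃ G, IsWeakGradient Ω w G then h.choose else 0

/-- The Sobolev space `H¹(Ω)`. -/
def sobolevH1 {d : ℕ} (Ω : Opens (EuclideanSpace ℝ (Fin d))) :
    Set (EuclideanSpace ℝ (Fin d) → ℝ) :=
  {w | MemLp w 2 (volume.restrict (Ω : Set (EuclideanSpace ℝ (Fin d)))) ∧
    (∃ G, IsWeakGradient Ω w G) ∧
    MemLp (weakGradient Ω w) 2 (volume.restrict (Ω : Set (EuclideanSpace ℝ (Fin d))))}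

/-- The norm of `H¹(Ω)`. -/
def sobolevH1Norm {d : ℕ} (Ω : Opens (EuclideanSpace ℝ (Fin d)))
    (w : EuclideanSpace ℝ (Fin d) → ℝ) : ℝ≥0∞ :=
  eLpNorm w 2 (volume.restrict (Ω : Set (EuclideanSpace ℝ (Fin d)))) +
    eLpNorm (weakGradient Ω w) 2 (volume.restrict (Ω : Set (EuclideanSpace ℝ (Fin d))))

/-- The Sobolev space `H¹₀(Ω)`: the closure of the test functions in `H¹(Ω)`. -/
def sobolevH10 {d : ℕ} (Ω : Opens (EuclideanSpace ℝ (Fin d))) :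
    Set (EuclideanSpace ℝ (Fin d) → ℝ) :=
  {w | w ∈ sobolevH1 Ω ∧ ∀ ε : ℝ, 0 < ε →
    ∃ ψ : 𝓓(Ω, ℝ), sobolevH1Norm Ω (w - ⇑ψ) < ENNReal.ofReal ε}

/-- The space `V = {w ∈ H¹₀(Ω) : ∇w ∈ E_φ(Ω)^d}`. -/
def spaceV {d : ℕ} (φ : EuclideanSpace ℝ (Fin d) → ℝ)
    (Ω : Opens (EuclideanSpace ℝ (Fin d))) : Set (EuclideanSpace ℝ (Fin d) → ℝ) :=
  {w | w ∈ sobolevH10 Ω ∧ weakGradient Ω w ∈ orliczE φ Ω}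

/-- The norm of `V`: the sum of the `L²` norm and the Luxemburg norm of the weak gradient. -/
def normV {d : ℕ} (φ : EuclideanSpace ℝ (Fin d) → ℝ)
    (Ω : Opens (EuclideanSpace ℝ (Fin d))) (w : EuclideanSpace ℝ (Fin d) → ℝ) : ℝ≥0∞ :=
  eLpNorm (weakGradient Ω w) 2 (volume.restrict (Ω : Set (EuclideanSpace ℝ (Fin d)))) +
    luxemburgNorm φ Ω (weakGradient Ω w)

end

/-! No doubling condition is imposed on `φ`, so convergence is handled through modulars of arbitrary
multiples. With `Φ = φ + ‖·‖²`, a modular of `l⁻¹ • F` at most `1` bounds both the Luxemburg and the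
`L²` norm of `F` by `l` (`normV_le_of_modular_le`). Membership of `∇w` in `E_φ` makes every multiple
of `∇w` have finite modular (`hasFiniteModulars_of_mem_orliczE`). The triangle inequality is
replaced by midpoint convexity, at the price of a factor `2` inside the gauge.

The function `w` is first truncated smoothly to `T_c(w) = c⁻¹ arctan(c w)`, and `T_c'(w) ∇w` tends
to `∇w` in modular by dominated convergence (`exists_arctanTrunc_modular_le`). Boundedness is
essential: localizing by a cutoff `η` creates the term `T_c(w) ∇η`, whose modulars could be infinite
for unbounded `w`. Because `w ∈ H¹₀(Ω)`, the truncation extended by zero has a weak gradient on the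
whole space (`hasGlobalWeakGradient_arctanTrunc`).

A partition of unity on the closure of `Ω` then yields pieces, each of which a small shift in one
direction moves into `Ω`. Mollifying with a kernel centred at the shift vector gives a test
function. Its gradient is an average of translates of the weak gradient, so Jensen's inequality
(`modular_average_translate_sub_le`) and continuity of translation in modular
(`tendsto_modular_translate_sub`) control the error. The pieces add up because the gradients of the
partition sum to zero in `Ω`. -/

/-! ### Convex gauges -/

/-- A continuous, convex, even function vanishing at the origin. -/
structure IsConvexGauge {E : Type*} [NormedAddCommGroup E] [NormedSpace ℝ E] (Φ : E → ℝ) :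
    Prop where
  continuous : Continuous Φ
  convex : ConvexOn ℝ Set.univ Φ
  map_zero : Φ 0 = 0
  even : ∀ ξ, Φ (-ξ) = Φ ξ

namespace IsConvexGauge

variable {E : Type*} [NormedAddCommGroup E] [NormedSpace ℝ E] {Φ : E → ℝ}

lemma map_half_add_le (hΦ : IsConvexGauge Φ) (a b : E) :
    Φ (a + b) ≤ (Φ ((2 : ℝ) • a) + Φ ((2 : ℝ) • b)) / 2 := by
  have h := hΦ.convex.2 (Set.mem_univ ((2 : ℝ) • a)) (Set.mem_univ ((2 : ℝ) • b))
    (by norm_num : (0 : ℝ) ≤ 1 / 2) (by norm_num : (0 : ℝ) ≤ 1 / 2) (by norm_num)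
  rw [smul_smul, smul_smul] at h
  norm_num at h
  linarith

lemma nonneg (hΦ : IsConvexGauge Φ) (ξ : E) : 0 ≤ Φ ξ := by
  have h := hΦ.map_half_add_le ((1 / 2 : ℝ) • ξ) (-((1 / 2 : ℝ) • ξ))
  rw [add_neg_cancel, hΦ.map_zero, smul_neg, hΦ.even, smul_smul] at h
  norm_num at h
  exact h

lemma map_smul_le (hΦ : IsConvexGauge Φ) {c : ℝ} (hc : |c| ≤ 1) (ξ : E) : Φ (c • ξ) ≤ Φ ξ := by
  have key : ∀ s : ℝ, 0 ≤ s → s ≤ 1 → Φ (s • ξ) ≤ Φ ξ := fun s h0 h1 => by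
    have h := hΦ.convex.2 (Set.mem_univ ξ) (Set.mem_univ (0 : E)) h0 (sub_nonneg.2 h1) (by ring)
    simp only [smul_zero, add_zero, hΦ.map_zero, smul_eq_mul, mul_zero] at h
    nlinarith [hΦ.nonneg ξ]
  rcases abs_cases c with ⟨h, h'⟩ | ⟨h, h'⟩
  · exact key c h' (h ▸ hc)
  · have := key (-c) (by linarith) (h ▸ hc)
    rwa [neg_smul, hΦ.even] at this

lemma map_smul_le_of_abs_le (hΦ : IsConvexGauge Φ) {a b : ℝ} (h : |a| ≤ |b|) (ξ : E) :
    Φ (a • ξ) ≤ Φ (b • ξ) := by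
  rcases eq_or_ne b 0 with rfl | hb
  · have : a = 0 := by simpa using h
    simp [this]
  · have h2 : a • ξ = (a / b) • b • ξ := by rw [smul_smul, div_mul_cancel₀ _ hb]
    rw [h2]
    refine hΦ.map_smul_le ?_ _
    rw [abs_div]
    exact div_le_one_of_le₀ h (abs_nonneg _)

end IsConvexGauge

lemma IsNFunction.isConvexGauge {d : ℕ} {φ : EuclideanSpace ℝ (Fin d) → ℝ} (hφ : IsNFunction φ) :
    IsConvexGauge φ :=
  ⟨hφ.continuous, hφ.convex, (hφ.eq_zero_iff 0).2 rfl, hφ.even⟩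

/-- This lets one gauge control both summands of the norm of `V`. -/
lemma IsConvexGauge.add_norm_sq {E : Type*} [NormedAddCommGroup E] [NormedSpace ℝ E] {Φ : E → ℝ}
    (hΦ : IsConvexGauge Φ) : IsConvexGauge (fun ξ => Φ ξ + ‖ξ‖ ^ 2) where
  continuous := hΦ.continuous.add (continuous_norm.pow 2)
  convex := hΦ.convex.add ((convexOn_norm convex_univ).pow (fun _ _ => norm_nonneg _) 2)
  map_zero := by simp [hΦ.map_zero]
  even ξ := by simp [hΦ.even]

/-! ### Modulars and functions all of whose multiples have finite modular -/

noncomputable section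

/-- The modular `∫ Φ(F) dμ`. -/
def modular {X E : Type*} [MeasurableSpace X] (Φ : E → ℝ) (μ : Measure X) (F : X → E) : ℝ≥0∞ :=
  ∫⁻ x, ENNReal.ofReal (Φ (F x)) ∂μ

end

section modular

variable {X E : Type*} [MeasurableSpace X] {μ : Measure X} {Φ : E → ℝ}

lemma modular_congr_ae {F G : X → E} (h : F =ᵐ[μ] G) : modular Φ μ F = modular Φ μ G :=
  lintegral_congr_ae (h.mono fun x hx => by simp only [hx])

lemma modular_mono {F G : X → E} (h : ∀ᵐ x ∂μ, Φ (F x) ≤ Φ (G x)) :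
    modular Φ μ F ≤ modular Φ μ G :=
  lintegral_mono_ae (h.mono fun _ hx => ENNReal.ofReal_le_ofReal hx)

variable [NormedAddCommGroup E] [NormedSpace ℝ E]

lemma IsConvexGauge.aemeasurable_comp (hΦ : IsConvexGauge Φ) {F : X → E}
    (hF : AEStronglyMeasurable F μ) : AEMeasurable (fun x => ENNReal.ofReal (Φ (F x))) μ :=
  (hΦ.continuous.comp_aestronglyMeasurable hF).aemeasurable.ennreal_ofReal

lemma IsConvexGauge.modular_smul_le (hΦ : IsConvexGauge Φ) {a b : ℝ} (h : |a| ≤ |b|) (F : X → E) :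
    modular Φ μ (a • F) ≤ modular Φ μ (b • F) :=
  modular_mono (.of_forall fun x => hΦ.map_smul_le_of_abs_le h (F x))

lemma IsConvexGauge.modular_add_le (hΦ : IsConvexGauge Φ) {F : X → E}
    (hF : AEStronglyMeasurable F μ) (G : X → E) :
    modular Φ μ (F + G) ≤ (modular Φ μ ((2 : ℝ) • F) + modular Φ μ ((2 : ℝ) • G)) / 2 := by
  unfold modular
  rw [← lintegral_add_left' (hΦ.aemeasurable_comp (hF.const_smul 2)), ENNReal.div_eq_inv_mul,
    ← lintegral_const_mul' _ _ (by simp)]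
  refine lintegral_mono fun x => ?_
  rw [← ENNReal.div_eq_inv_mul]
  simp only [Pi.add_apply, Pi.smul_apply]
  rw [← ENNReal.ofReal_add (hΦ.nonneg _) (hΦ.nonneg _),
    ← ENNReal.ofReal_ofNat 2, ← ENNReal.ofReal_div_of_pos two_pos]
  exact ENNReal.ofReal_le_ofReal (hΦ.map_half_add_le _ _)

lemma IsConvexGauge.modular_add_le_one (hΦ : IsConvexGauge Φ) {F G : X → E}
    (hF : AEStronglyMeasurable F μ) (h1 : modular Φ μ ((2 : ℝ) • F) ≤ 1)
    (h2 : modular Φ μ ((2 : ℝ) • G) ≤ 1) : modular Φ μ (F + G) ≤ 1 := by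
  refine (hΦ.modular_add_le hF G).trans ?_
  refine ENNReal.div_le_of_le_mul ?_
  rw [one_mul]
  exact (add_le_add h1 h2).trans (by norm_num)

/-- All multiples of `F` have finite modular. -/
def HasFiniteModulars (Φ : E → ℝ) (μ : Measure X) (F : X → E) : Prop :=
  ∀ c : ℝ, modular Φ μ (c • F) < ∞

lemma HasFiniteModulars.add (hΦ : IsConvexGauge Φ) {F G : X → E} (hFm : AEStronglyMeasurable F μ)
    (hF : HasFiniteModulars Φ μ F) (hG : HasFiniteModulars Φ μ G) :
    HasFiniteModulars Φ μ (F + G) := fun c => by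
  rw [smul_add]
  refine (hΦ.modular_add_le (hFm.const_smul c) _).trans_lt ?_
  refine ENNReal.div_lt_top (ENNReal.add_lt_top.2 ⟨?_, ?_⟩).ne (by norm_num)
  · rw [smul_smul]; exact hF _
  · rw [smul_smul]; exact hG _

lemma HasFiniteModulars.congr_ae {F G : X → E} (hF : HasFiniteModulars Φ μ F) (h : F =ᵐ[μ] G) :
    HasFiniteModulars Φ μ G := fun c => by
  rw [← modular_congr_ae (h.const_smul c)]
  exact hF c

lemma HasFiniteModulars.bdd_smul (hΦ : IsConvexGauge Φ) {F : X → E} (hF : HasFiniteModulars Φ μ F)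
    {η : X → ℝ} {C : ℝ} (hη : ∀ x, |η x| ≤ C) : HasFiniteModulars Φ μ (fun x => η x • F x) :=
  fun c => by
  refine (modular_mono (.of_forall fun x => ?_)).trans_lt (hF (c * C))
  simp only [Pi.smul_apply]
  rw [smul_smul]
  refine hΦ.map_smul_le_of_abs_le ?_ _
  rw [abs_mul, abs_mul]
  exact mul_le_mul_of_nonneg_left ((hη x).trans (le_abs_self C)) (abs_nonneg c)

/-- The continuous gauge is bounded on the compact ball containing the values of `c • F`, and it
vanishes off `K`. As `K` need not be measurable, its measurable hull is used. -/
lemma HasFiniteModulars.of_bounded [ProperSpace E] (hΦ : IsConvexGauge Φ) {F : X → E}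
    {K : Set X} (hK : μ K < ∞) (hFK : ∀ x ∉ K, F x = 0)
    {C : ℝ} (hC : ∀ x, ‖F x‖ ≤ C) : HasFiniteModulars Φ μ F := fun c => by
  obtain ⟨M, hM⟩ := (isCompact_closedBall (0 : E) (|c| * C)).bddAbove_image
    hΦ.continuous.continuousOn
  calc modular Φ μ (c • F) ≤ ∫⁻ x, (toMeasurable μ K).indicator (fun _ => ENNReal.ofReal M) x ∂μ := by
        refine lintegral_mono fun x => ?_
        by_cases hx : x ∈ toMeasurable μ K
        · rw [Set.indicator_of_mem hx]
          refine ENNReal.ofReal_le_ofReal (hM (Set.mem_image_of_mem _ ?_))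
          rw [mem_closedBall_zero_iff, Pi.smul_apply, norm_smul, Real.norm_eq_abs]
          exact mul_le_mul_of_nonneg_left (hC x) (abs_nonneg c)
        · rw [Set.indicator_of_notMem hx, Pi.smul_apply,
            hFK x fun h => hx (subset_toMeasurable μ K h), smul_zero, hΦ.map_zero,
            ENNReal.ofReal_zero]
    _ < ∞ := by
        rw [lintegral_indicator (measurableSet_toMeasurable _ _), lintegral_const,
          Measure.restrict_apply_univ, measure_toMeasurable]
        exact ENNReal.mul_lt_top ENNReal.ofReal_lt_top hK

end modular

/-! ### Translations: continuity in modular and Jensen's inequality -/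

section translation

variable {V E : Type*} [NormedAddCommGroup V] [NormedSpace ℝ V] [FiniteDimensional ℝ V]
  [MeasurableSpace V] [BorelSpace V] {μ : Measure V} [μ.IsAddHaarMeasure]
  [NormedAddCommGroup E]

/-- Translation is continuous in `L¹`. -/
lemma tendsto_lintegral_enorm_translate_sub {f : V → E} (hf : Integrable f μ) :
    Tendsto (fun y => ∫⁻ x, ‖f (x - y) - f x‖ₑ ∂μ) (𝓝 0) (𝓝 0) := by
  have hf1 : MemLp f 1 μ := memLp_one_iff_integrable.2 hf
  let G : C(V, C(V, V)) := ContinuousMap.curry ⟨fun p : V × V => p.2 - p.1, by fun_prop⟩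
  have hG : ∀ y, MeasurePreserving (G y) μ μ := fun y => measurePreserving_sub_right μ y
  have h := Filter.Tendsto.compMeasurePreservingLp (μ := μ) (ν := μ)
    (tendsto_const_nhds (x := hf1.toLp f) (f := 𝓝 (0 : V))) (G.continuous.tendsto 0) hG (hG 0)
    ENNReal.one_ne_top
  rw [tendsto_iff_edist_tendsto_0] at h
  refine h.congr fun y => ?_
  rw [Lp.edist_def, eLpNorm_one_eq_lintegral_enorm]
  refine lintegral_congr_ae ?_
  have h1 := Lp.coeFn_compMeasurePreserving (hf1.toLp f) (hG y)
  have h2 := Lp.coeFn_compMeasurePreserving (hf1.toLp f) (hG 0)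
  have h3 := (hG y).quasiMeasurePreserving.ae_eq_comp hf1.coeFn_toLp
  have h4 := (hG 0).quasiMeasurePreserving.ae_eq_comp hf1.coeFn_toLp
  filter_upwards [h1, h2, h3, h4] with x e1 e2 e3 e4
  rw [Pi.sub_apply, e1, e2, e3, e4]
  simp [G]

/-- Translation is continuous with respect to a modular. -/
lemma tendsto_modular_translate_sub [NormedSpace ℝ E] {Φ : E → ℝ} (hΦ : IsConvexGauge Φ) {F : V → E}
    (hF : Integrable F μ) (hfin : HasFiniteModulars Φ μ F) (c : ℝ) :
    Tendsto (fun y => modular Φ μ (fun x => c • (F (x - y) - F x))) (𝓝 0) (𝓝 0) := by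
  -- By midpoint convexity the integrand is at most `(Ψ (x - y) + Ψ x) / 2`, a bound that moves with
  -- `y`.
  set Ψ : V → ℝ := fun x => Φ ((2 * c) • F x) with hΨ
  have hΨi : Integrable Ψ μ := by
    refine ⟨hΦ.continuous.comp_aestronglyMeasurable (hF.1.const_smul _), ?_⟩
    rw [hasFiniteIntegral_iff_ofReal (.of_forall fun x => hΦ.nonneg _)]
    exact hfin (2 * c)
  have htr : ∀ y, AEStronglyMeasurable (fun x => F (x - y)) μ := fun y =>
    hF.1.comp_measurePreserving (measurePreserving_sub_right μ y)
  have hmX : ∀ y, AEMeasurable (fun x => ENNReal.ofReal (Φ (c • (F (x - y) - F x)))) μ := fun y =>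
    hΦ.aemeasurable_comp (((htr y).sub hF.1).const_smul c)
  refine tendsto_of_subseq_tendsto fun ys hys => ?_
  have hFm : TendstoInMeasure μ (fun n x => F (x - ys n)) atTop F := by
    refine tendstoInMeasure_of_tendsto_eLpNorm one_ne_zero (fun n => htr _) hF.1 ?_
    simp only [eLpNorm_one_eq_lintegral_enorm]
    exact (tendsto_lintegral_enorm_translate_sub hF).comp hys
  obtain ⟨ms, hms, hlim⟩ := hFm.exists_seq_tendsto_ae
  refine ⟨ms, ?_⟩
  have hys' := hys.comp hms.tendsto_atTop
  -- The integrand is at most its minimum with `Ψ x` plus `|Ψ (x - y) - Ψ x|`. The minimum has a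
  -- fixed integrable majorant; the remainder vanishes by continuity of translation in `L¹`.
  have hmin : Tendsto (fun n => ∫⁻ x, min (ENNReal.ofReal (Φ (c • (F (x - ys (ms n)) - F x))))
      (ENNReal.ofReal (Ψ x)) ∂μ) atTop (𝓝 (∫⁻ _, 0 ∂μ)) := by
    refine tendsto_lintegral_of_dominated_convergence' (fun x => ENNReal.ofReal (Ψ x))
      (fun n => (hmX _).min hΨi.1.aemeasurable.ennreal_ofReal)
      (fun n => .of_forall fun x => min_le_right _ _) (hfin (2 * c)).ne ?_
    filter_upwards [hlim] with x hx
    have h1 : Tendsto (fun n => ENNReal.ofReal (Φ (c • (F (x - ys (ms n)) - F x)))) atTop (𝓝 0) := by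
      have h2 : Tendsto (fun n => c • (F (x - ys (ms n)) - F x)) atTop (𝓝 0) := by
        simpa using (hx.sub_const (F x)).const_smul c
      have h3 := ENNReal.tendsto_ofReal ((hΦ.continuous.tendsto 0).comp h2)
      rw [hΦ.map_zero, ENNReal.ofReal_zero] at h3
      exact h3
    exact tendsto_of_tendsto_of_tendsto_of_le_of_le tendsto_const_nhds h1 (fun _ => zero_le)
      (fun _ => min_le_left _ _)
  have hΨt := (tendsto_lintegral_enorm_translate_sub hΨi).comp hys'
  have hsum := hΨt.add hmin
  rw [lintegral_zero, add_zero] at hsum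
  refine tendsto_of_tendsto_of_tendsto_of_le_of_le tendsto_const_nhds hsum (fun _ => zero_le)
    fun n => ?_
  set y := ys (ms n)
  have hΨy : AEMeasurable (fun x => ‖Ψ (x - y) - Ψ x‖ₑ) μ :=
    ((hΨi.1.comp_measurePreserving (measurePreserving_sub_right μ y)).sub hΨi.1).enorm
  refine le_trans ?_ (lintegral_add_left' hΨy _).le
  refine lintegral_mono fun x => ?_
  have key : Φ (c • (F (x - y) - F x)) ≤ |Ψ (x - y) - Ψ x| + Ψ x := by
    have h1 := hΦ.map_half_add_le (c • F (x - y)) (-(c • F x))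
    rw [smul_neg, hΦ.even, smul_smul, smul_smul, ← sub_eq_add_neg, ← smul_sub] at h1
    have h2 := le_abs_self (Ψ (x - y) - Ψ x)
    have h3 := abs_nonneg (Ψ (x - y) - Ψ x)
    simp only [hΨ] at h2 h3 ⊢
    linarith
  rcases le_total (Φ (c • (F (x - y) - F x))) (Ψ x) with h | h
  · show ENNReal.ofReal (Φ (c • (F (x - y) - F x))) ≤ _
    rw [min_eq_left (ENNReal.ofReal_le_ofReal h)]
    exact le_add_self
  · show ENNReal.ofReal (Φ (c • (F (x - y) - F x))) ≤ _
    rw [min_eq_right (ENNReal.ofReal_le_ofReal h), Real.enorm_eq_ofReal_abs,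
      ← ENNReal.ofReal_add (abs_nonneg _) (hΦ.nonneg _)]
    exact ENNReal.ofReal_le_ofReal key

/-- Jensen's inequality for a modular of an average over translations. -/
lemma modular_average_translate_sub_le [NormedSpace ℝ E] [CompleteSpace E] {Φ : E → ℝ}
    (hΦ : IsConvexGauge Φ) {F : V → E} (hF : StronglyMeasurable F) {ν : Measure V}
    [IsProbabilityMeasure ν] (hint : ∀ x, Integrable (fun y => F (x - y)) ν) {c : ℝ} {B : ℝ≥0∞}
    (hB : ∀ᵐ y ∂ν, modular Φ μ (fun x => c • (F (x - y) - F x)) ≤ B) :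
    modular Φ μ (fun x => c • (∫ y, F (x - y) ∂ν - F x)) ≤ B := by
  have hmeas : Measurable (fun p : V × V => ENNReal.ofReal (Φ (c • (F (p.1 - p.2) - F p.1)))) := by
    have h1 : StronglyMeasurable (fun p : V × V => F (p.1 - p.2)) :=
      hF.comp_measurable (measurable_fst.sub measurable_snd)
    have h2 : StronglyMeasurable (fun p : V × V => F p.1) := hF.comp_measurable measurable_fst
    exact (hΦ.continuous.comp_stronglyMeasurable ((h1.sub h2).const_smul c)).measurable.ennreal_ofReal
  calc modular Φ μ (fun x => c • (∫ y, F (x - y) ∂ν - F x))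
      ≤ ∫⁻ x, ∫⁻ y, ENNReal.ofReal (Φ (c • (F (x - y) - F x))) ∂ν ∂μ := by
        refine lintegral_mono fun x => ?_
        have hi : Integrable (fun y => c • (F (x - y) - F x)) ν :=
          ((hint x).sub (integrable_const _)).smul c
        have he : c • (∫ y, F (x - y) ∂ν - F x) = ∫ y, c • (F (x - y) - F x) ∂ν := by
          rw [integral_smul, integral_sub (hint x) (integrable_const _)]
          simp
        simp only
        rw [he]
        -- Jensen's inequality needs an integrable composition; otherwise the right side is
        -- infinite.
        by_cases hfin : ∫⁻ y, ENNReal.ofReal (Φ (c • (F (x - y) - F x))) ∂ν = ∞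
        · rw [hfin]; exact le_top
        · have hgi : Integrable (fun y => Φ (c • (F (x - y) - F x))) ν := by
            refine ⟨hΦ.continuous.comp_aestronglyMeasurable hi.1, ?_⟩
            rw [hasFiniteIntegral_iff_ofReal (.of_forall fun y => hΦ.nonneg _)]
            exact lt_top_iff_ne_top.2 hfin
          rw [← ofReal_integral_eq_lintegral_ofReal hgi (.of_forall fun y => hΦ.nonneg _)]
          exact ENNReal.ofReal_le_ofReal (hΦ.convex.map_integral_le hΦ.continuous.continuousOn
            isClosed_univ (.of_forall fun _ => Set.mem_univ _) hi hgi)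
    _ = ∫⁻ y, ∫⁻ x, ENNReal.ofReal (Φ (c • (F (x - y) - F x))) ∂μ ∂ν :=
        lintegral_lintegral_swap hmeas.aemeasurable
    _ ≤ ∫⁻ _, B ∂ν := lintegral_mono_ae hB
    _ = B := by simp

end translation

/-! ### Gradients and off-centre mollification -/

section

open scoped ContDiff

section gradient

variable {V : Type*} [NormedAddCommGroup V] [InnerProductSpace ℝ V] [CompleteSpace V]
  {f g : V → ℝ} {x : V}

lemma ContDiff.continuous_gradient (hf : ContDiff ℝ ∞ f) : Continuous (gradient f) :=
  (InnerProductSpace.toDual ℝ V).symm.continuous.comp (hf.continuous_fderiv (by simp))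

lemma tsupport_gradient_subset : tsupport (gradient f) ⊆ tsupport f := by
  refine (closure_mono fun x hx => ?_).trans (tsupport_fderiv_subset ℝ (f := f))
  intro h
  exact hx (by simp [gradient, h])

lemma HasCompactSupport.gradient (hf : HasCompactSupport f) : HasCompactSupport (gradient f) :=
  IsCompact.of_isClosed_subset hf (isClosed_tsupport _) tsupport_gradient_subset

lemma HasGradientAt.mul' {f' g' : V} (hf : HasGradientAt f f' x) (hg : HasGradientAt g g' x) :
    HasGradientAt (fun y => f y * g y) (f x • g' + g x • f') x := by
  rw [hasGradientAt_iff_hasFDerivAt] at *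
  refine (hf.mul hg).congr_fderiv ?_
  ext v
  simp

lemma HasGradientAt.add' {f' g' : V} (hf : HasGradientAt f f' x) (hg : HasGradientAt g g' x) :
    HasGradientAt (fun y => f y + g y) (f' + g') x := by
  rw [hasGradientAt_iff_hasFDerivAt] at *
  refine (hf.add hg).congr_fderiv ?_
  ext v
  simp

lemma HasDerivAt.comp_hasGradientAt {T : ℝ → ℝ} {T' : ℝ} {f' : V} (hT : HasDerivAt T T' (f x))
    (hf : HasGradientAt f f' x) : HasGradientAt (fun y => T (f y)) (T' • f') x := by
  rw [hasGradientAt_iff_hasFDerivAt] at *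
  refine (hT.comp_hasFDerivAt x hf).congr_fderiv ?_
  ext v
  simp

lemma ContDiff.hasGradientAt (hf : ContDiff ℝ ∞ f) (x : V) : HasGradientAt f (gradient f x) x :=
  (hf.differentiable (by simp) x).hasGradientAt

lemma gradient_comp_const_sub (hf : ContDiff ℝ ∞ f) (a t : V) :
    gradient (fun t => f (a - t)) t = -gradient f (a - t) := by
  refine HasGradientAt.gradient ?_
  rw [hasGradientAt_iff_hasFDerivAt]
  have h1 := (hf.hasGradientAt (a - t)).hasFDerivAt
  have h2 : HasFDerivAt (fun t : V => a - t) (-ContinuousLinearMap.id ℝ V) t :=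
    (hasFDerivAt_id t).const_sub a
  refine (h1.comp t h2).congr_fderiv ?_
  ext v
  simp

end gradient

variable {d : ℕ}

/-- `G` is an integrable weak gradient on the whole space of the integrable function `u`. -/
structure HasGlobalWeakGradient (u : EuclideanSpace ℝ (Fin d) → ℝ)
    (G : EuclideanSpace ℝ (Fin d) → EuclideanSpace ℝ (Fin d)) : Prop where
  integrable : Integrable u
  integrable_grad : Integrable G
  integral_eq : ∀ ψ : EuclideanSpace ℝ (Fin d) → ℝ, ContDiff ℝ ∞ ψ → HasCompactSupport ψ →
    ∫ x, u x • gradient ψ x = - ∫ x, ψ x • G x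

/-- The gradient of a mollification is the mollification of the weak gradient. -/
lemma HasGlobalWeakGradient.gradient_convolution {u : EuclideanSpace ℝ (Fin d) → ℝ}
    {G : EuclideanSpace ℝ (Fin d) → EuclideanSpace ℝ (Fin d)} (h : HasGlobalWeakGradient u G)
    {k : EuclideanSpace ℝ (Fin d) → ℝ} (hk : ContDiff ℝ ∞ k) (hkc : HasCompactSupport k)
    (x : EuclideanSpace ℝ (Fin d)) :
    gradient (convolution u k (ContinuousLinearMap.mul ℝ ℝ) volume) x =
      ∫ y, k y • G (x - y) := by
  -- The weak gradient identity is tested with the reflected kernel `t ↦ k (x - t)`; the reflection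
  -- accounts for the sign.
  have hxk : ContDiff ℝ ∞ (fun t => k (x - t)) := hk.comp (contDiff_const.sub contDiff_id)
  have hxkc : HasCompactSupport (fun t => k (x - t)) :=
    hkc.comp_homeomorph (Homeomorph.subLeft x)
  have hd := hkc.hasFDerivAt_convolution_right (ContinuousLinearMap.mul ℝ ℝ)
    h.integrable.locallyIntegrable (hk.of_le (by simp)) x
  have hint : Integrable (fun t => u t • gradient (fun t => k (x - t)) t) :=
    h.integrable.smul_of_top_left ((hxk.continuous_gradient.memLp_of_hasCompactSupport
      hxkc.gradient))
  have hswap : ∫ y, k y • G (x - y) = ∫ t, k (x - t) • G t := by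
    rw [← integral_sub_left_eq_self (fun y => k y • G (x - y)) volume x]
    simp
  rw [hswap, ← neg_eq_iff_eq_neg.2 (h.integral_eq _ hxk hxkc), ← integral_neg]
  refine ext_inner_right ℝ fun v => ?_
  rw [inner_gradient_left, hd.fderiv, convolution_precompR_apply _
    h.integrable.locallyIntegrable (hkc.fderiv ℝ) (hk.continuous_fderiv (by simp)), convolution_def,
    real_inner_comm, ← integral_inner (f := fun t => -(u t • gradient (fun t => k (x - t)) t)) hint.neg]
  refine integral_congr_ae (.of_forall fun t => ?_)
  simp only [ContinuousLinearMap.mul_apply']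
  rw [gradient_comp_const_sub hk, smul_neg, neg_neg, real_inner_smul_right, real_inner_comm,
    inner_gradient_left]

lemma HasGlobalWeakGradient.congr_ae {u : EuclideanSpace ℝ (Fin d) → ℝ}
    {G G' : EuclideanSpace ℝ (Fin d) → EuclideanSpace ℝ (Fin d)} (h : HasGlobalWeakGradient u G)
    (hG : G =ᵐ[volume] G') : HasGlobalWeakGradient u G' where
  integrable := h.integrable
  integrable_grad := h.integrable_grad.congr hG
  integral_eq ψ h1 h2 := by
    rw [h.integral_eq ψ h1 h2]
    congr 1
    exact integral_congr_ae (hG.mono fun x hx => by simp only [hx])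

open scoped Pointwise in
/-- Mollification with a kernel supported near the origin, but not necessarily centred there,
approximates the gradient with respect to a modular. -/
lemma HasGlobalWeakGradient.exists_mollification {u : EuclideanSpace ℝ (Fin d) → ℝ}
    {G : EuclideanSpace ℝ (Fin d) → EuclideanSpace ℝ (Fin d)} (h : HasGlobalWeakGradient u G)
    (hu : HasCompactSupport u) {Φ : EuclideanSpace ℝ (Fin d) → ℝ} (hΦ : IsConvexGauge Φ)
    (hfin : HasFiniteModulars Φ volume G) (c : ℝ) :
    ∃ δ > 0, ∀ (v : EuclideanSpace ℝ (Fin d)) (r : ℝ), 0 < r → ‖v‖ + r < δ →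
      ∃ ψ : EuclideanSpace ℝ (Fin d) → ℝ, ContDiff ℝ ∞ ψ ∧ HasCompactSupport ψ ∧
        (tsupport ψ ⊆ Metric.closedBall v r + tsupport u) ∧
        modular Φ volume (c • (gradient ψ - G)) ≤ 1 := by
  -- Joint measurability of `G (x - y)`, needed for Tonelli, calls for a strongly measurable
  -- representative.
  wlog hGm : StronglyMeasurable G generalizing G
  · have hGe := h.integrable_grad.1.ae_eq_mk
    obtain ⟨δ, hδ, H⟩ := this (h.congr_ae hGe) (hfin.congr_ae hGe)
      h.integrable_grad.1.stronglyMeasurable_mk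
    refine ⟨δ, hδ, fun v r hr hvr => ?_⟩
    obtain ⟨ψ, h1, h2, h3, h4⟩ := H v r hr hvr
    refine ⟨ψ, h1, h2, h3, ?_⟩
    rwa [modular_congr_ae (((EventuallyEq.refl _ (gradient ψ)).sub hGe).const_smul c)]
  have ht := tendsto_modular_translate_sub hΦ h.integrable_grad hfin c
  obtain ⟨δ, hδ, hball⟩ := Metric.eventually_nhds_iff.1 (ht.eventually_le_const one_pos)
  refine ⟨δ, hδ, fun v r hr hvr => ?_⟩
  let b : ContDiffBump v := ⟨r / 2, r, by positivity, by linarith⟩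
  set k := b.normed volume with hkdef
  have hk : ContDiff ℝ ∞ k := b.contDiff_normed
  have hkc : HasCompactSupport k := b.hasCompactSupport_normed
  have hksupp : Function.support k = Metric.ball v r := b.support_normed_eq
  have hk0 : ∀ y, 0 ≤ k y := b.nonneg_normed
  set ψ := convolution u k (ContinuousLinearMap.mul ℝ ℝ) volume with hψ
  have hcomp : IsCompact (Metric.closedBall v r + tsupport u) :=
    (isCompact_closedBall v r).add hu
  have hsub : Function.support ψ ⊆ Metric.closedBall v r + tsupport u := by
    refine (support_convolution_subset_swap _).trans (Set.add_subset_add ?_ subset_closure)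
    rw [hksupp]
    exact Metric.ball_subset_closedBall
  have htsub : tsupport ψ ⊆ Metric.closedBall v r + tsupport u :=
    closure_minimal hsub hcomp.isClosed
  refine ⟨ψ, hkc.contDiff_convolution_right _ h.integrable.locallyIntegrable hk,
    hcomp.of_isClosed_subset (isClosed_tsupport _) htsub, htsub, ?_⟩
  -- The normalized kernel is the density of a probability measure carried by the ball of radius `r`
  -- about `v`, all of whose points have norm less than `δ`.
  set ν : Measure (EuclideanSpace ℝ (Fin d)) :=
    volume.withDensity (fun y => ((k y).toNNReal : ℝ≥0∞)) with hν
  have hkm : Measurable fun y => (k y).toNNReal := hk.continuous.measurable.real_toNNReal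
  have hprob : IsProbabilityMeasure ν := ⟨by
    rw [hν, withDensity_apply _ MeasurableSet.univ, Measure.restrict_univ]
    change ∫⁻ y, ENNReal.ofReal (k y) = 1
    rw [← ofReal_integral_eq_lintegral_ofReal b.integrable_normed (.of_forall hk0),
      b.integral_normed, ENNReal.ofReal_one]⟩
  have hval : ∀ x, gradient ψ x = ∫ y, G (x - y) ∂ν := fun x => by
    rw [hψ, h.gradient_convolution hk hkc, hν, integral_withDensity_eq_integral_smul hkm]
    refine integral_congr_ae (.of_forall fun y => ?_)
    simp [NNReal.smul_def, hk0 y]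
  have hint : ∀ x, Integrable (fun y => G (x - y)) ν := fun x => by
    rw [hν, integrable_withDensity_iff_integrable_smul hkm]
    have h1 : Integrable (fun y => k y • G (x - y)) :=
      (h.integrable_grad.comp_sub_left x).smul_of_top_right
        (hk.continuous.memLp_of_hasCompactSupport hkc)
    refine h1.congr (.of_forall fun y => ?_)
    simp [NNReal.smul_def, hk0 y]
  have hB : ∀ᵐ y ∂ν, modular Φ volume (fun x => c • (G (x - y) - G x)) ≤ 1 := by
    rw [hν, ae_withDensity_iff hkm.coe_nnreal_ennreal]
    refine .of_forall fun y hy => hball ?_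
    have hky : k y ≠ 0 := fun h0 => hy (by simp [h0])
    have hyb : y ∈ Metric.ball v r := hksupp ▸ hky
    rw [dist_zero_right]
    rw [mem_ball_iff_norm] at hyb
    have := norm_add_le (y - v) v
    rw [sub_add_cancel] at this
    linarith
  have := modular_average_translate_sub_le (μ := volume) hΦ hGm hint hB
  simp_rw [← hval] at this
  exact this

end

/-! ### Shifting into a Lipschitz domain, and the partition of unity -/

section

open scoped ContDiff

variable {d : ℕ}

open scoped Pointwise in
/-- A function whose support can be pushed into `Ω` by small translations along `v` is approximated
by test functions on `Ω`. -/
lemma HasGlobalWeakGradient.exists_testFunction {Ω : Opens (EuclideanSpace ℝ (Fin d))}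
    {u : EuclideanSpace ℝ (Fin d) → ℝ}
    {G : EuclideanSpace ℝ (Fin d) → EuclideanSpace ℝ (Fin d)} (h : HasGlobalWeakGradient u G)
    (hu : HasCompactSupport u) {Φ : EuclideanSpace ℝ (Fin d) → ℝ} (hΦ : IsConvexGauge Φ)
    (hfin : HasFiniteModulars Φ volume G) {v : EuclideanSpace ℝ (Fin d)} {t₀ : ℝ} (ht₀ : 0 < t₀)
    (hv : ∀ y ∈ tsupport u, ∀ t, 0 < t → t < t₀ → y + t • v ∈ Ω) (c : ℝ) :
    ∃ ψ : 𝓓(Ω, ℝ), modular Φ volume (c • (gradient ψ - G)) ≤ 1 := by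
  obtain ⟨δ, hδ, H⟩ := h.exists_mollification hu hΦ hfin c
  -- The shift uses less than `δ / 2` and the kernel radius at most `δ / 4`. The `+ 1` in the
  -- denominator covers `v = 0`.
  obtain ⟨t, ht, htt, htv⟩ : ∃ t, 0 < t ∧ t < t₀ ∧ t * ‖v‖ < δ / 2 := by
    refine ⟨min (t₀ / 2) (δ / 4 / (‖v‖ + 1)), by positivity, ?_, ?_⟩
    · exact (min_le_left _ _).trans_lt (by linarith)
    · calc min (t₀ / 2) (δ / 4 / (‖v‖ + 1)) * ‖v‖ ≤ δ / 4 / (‖v‖ + 1) * (‖v‖ + 1) := by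
            gcongr
            · exact min_le_right _ _
            · linarith
        _ = δ / 4 := by field_simp
        _ < δ / 2 := by linarith
  have hK : IsCompact ((fun y => y + t • v) '' tsupport u) :=
    IsCompact.image hu (by fun_prop)
  have hKΩ : (fun y => y + t • v) '' tsupport u ⊆ (Ω : Set (EuclideanSpace ℝ (Fin d))) := by
    rintro _ ⟨y, hy, rfl⟩
    exact hv y hy t ht htt
  -- The shifted support is compact in `Ω`, which leaves room for a kernel of positive radius.
  obtain ⟨r, hr, hrΩ⟩ := hK.exists_cthickening_subset_open Ω.isOpen hKΩ
  have hmin : 0 < min r (δ / 4) := lt_min hr (by linarith)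
  obtain ⟨ψ, h1, h2, h3, h4⟩ := H (t • v) (min r (δ / 4)) hmin (by
    rw [norm_smul, Real.norm_of_nonneg ht.le]
    linarith [min_le_right r (δ / 4)])
  refine ⟨⟨ψ, h1, h2, ?_⟩, h4⟩
  refine h3.trans (Set.Subset.trans ?_ hrΩ)
  rintro _ ⟨a, ha, y, hy, rfl⟩
  refine Metric.mem_cthickening_of_dist_le _ (y + t • v) _ _ ⟨y, hy, rfl⟩ ?_
  rw [Metric.mem_closedBall] at ha
  show dist (a + y) (y + t • v) ≤ r
  rw [add_comm y, dist_add_right]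
  exact ha.trans (min_le_left _ _)

/-- Near any point of its closure, a Lipschitz domain is shifted into itself by small translations
in a suitable direction. -/
lemma IsBoundedLipschitzDomain.exists_translate_mem {Ω : Opens (EuclideanSpace ℝ (Fin d))}
    (hΩ : IsBoundedLipschitzDomain Ω) {x : EuclideanSpace ℝ (Fin d)}
    (hx : x ∈ closure (Ω : Set (EuclideanSpace ℝ (Fin d)))) :
    ∃ r > 0, ∃ (v : EuclideanSpace ℝ (Fin d)) (t₀ : ℝ), 0 < t₀ ∧
      ∀ y ∈ closure (Ω : Set (EuclideanSpace ℝ (Fin d))), y ∈ Metric.ball x r →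
        ∀ t, 0 < t → t < t₀ → y + t • v ∈ Ω := by
  by_cases hxΩ : x ∈ Ω
  · obtain ⟨r, hr, hball⟩ := Metric.isOpen_iff.1 Ω.isOpen x hxΩ
    exact ⟨r, hr, 0, 1, one_pos, fun y _ hy t _ _ => by simpa using hball hy⟩
  · obtain ⟨r, hr, e, he, K, lam, hlam, hloc⟩ := hΩ.lipschitz_boundary x
      ⟨hx, by rwa [Ω.isOpen.interior_eq]⟩
    -- Half radii keep the shifted point in the ball of radius `r`. Points of the closure satisfy
    -- the graph inequality weakly; moving along `-e` fixes the projection and lowers the height by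
    -- `t`, which makes it strict.
    refine ⟨r / 2, by positivity, -e, r / 2, by positivity, fun y hy hyx t ht htr => ?_⟩
    rw [Metric.mem_ball] at hyx
    have hyball : y ∈ Metric.ball x r := by
      rw [Metric.mem_ball]; linarith
    have hcl : y ∈ closure ((Ω : Set (EuclideanSpace ℝ (Fin d))) ∩ Metric.ball x r) :=
      Metric.isOpen_ball.closure_inter ⟨hy, hyball⟩
    have hle : ⟪e, y⟫ ≤ lam ((Submodule.span ℝ {e})ᗮ.orthogonalProjectionOnto y) := by
      have hclosed : IsClosed {y : EuclideanSpace ℝ (Fin d) |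
          ⟪e, y⟫ ≤ lam ((Submodule.span ℝ {e})ᗮ.orthogonalProjectionOnto y)} :=
        isClosed_le (by fun_prop) (hlam.continuous.comp (ContinuousLinearMap.continuous _))
      refine closure_minimal (fun z hz => ?_) hclosed hcl
      rw [hloc] at hz
      exact hz.2.le
    have hproj : (Submodule.span ℝ {e})ᗮ.orthogonalProjectionOnto (y + t • -e) =
        (Submodule.span ℝ {e})ᗮ.orthogonalProjectionOnto y := by
      rw [map_add, map_smul, map_neg,
        Submodule.orthogonalProjectionOnto_orthogonal_apply_eq_zero
          (Submodule.mem_span_singleton_self e)]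
      simp
    have hmem : y + t • -e ∈ (Ω : Set (EuclideanSpace ℝ (Fin d))) ∩ Metric.ball x r := by
      rw [hloc]
      refine ⟨?_, ?_⟩
      · have h1 : dist (y + t • -e) y = t := by
          rw [dist_eq_norm, add_sub_cancel_left, norm_smul, norm_neg, he, mul_one,
            Real.norm_of_nonneg ht.le]
        have := dist_triangle (y + t • -e) y x
        rw [Metric.mem_ball]
        linarith
      · rw [hproj, inner_add_right, real_inner_smul_right, inner_neg_right,
          real_inner_self_eq_norm_sq, he]
        linarith
    exact hmem.1

/-- A partition of unity on the closure of a Lipschitz domain, each member of which is supported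
where small translations in one direction shift the domain into itself. -/
lemma IsBoundedLipschitzDomain.exists_partitionOfUnity {Ω : Opens (EuclideanSpace ℝ (Fin d))}
    (hΩ : IsBoundedLipschitzDomain Ω) :
    ∃ (s : Finset (closure (Ω : Set (EuclideanSpace ℝ (Fin d)))))
      (η : s → EuclideanSpace ℝ (Fin d) → ℝ),
      (∀ i, ContDiff ℝ ∞ (η i)) ∧ (∀ i, HasCompactSupport (η i)) ∧
      (∀ x ∈ closure (Ω : Set (EuclideanSpace ℝ (Fin d))), ∑ i, η i x = 1) ∧
      ∀ i, ∃ (v : EuclideanSpace ℝ (Fin d)) (t₀ : ℝ), 0 < t₀ ∧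
        ∀ y ∈ closure (Ω : Set (EuclideanSpace ℝ (Fin d))), y ∈ tsupport (η i) →
          ∀ t, 0 < t → t < t₀ → y + t • v ∈ Ω := by
  choose r hr v t₀ ht₀ H using
    fun x : closure (Ω : Set (EuclideanSpace ℝ (Fin d))) => hΩ.exists_translate_mem x.2
  have hcomp : IsCompact (closure (Ω : Set (EuclideanSpace ℝ (Fin d)))) :=
    hΩ.isBounded.isCompact_closure
  obtain ⟨s, hs⟩ := hcomp.elim_finite_subcover
    (fun x : closure (Ω : Set (EuclideanSpace ℝ (Fin d))) =>
      Metric.ball (x : EuclideanSpace ℝ (Fin d)) (r x)) (fun _ => Metric.isOpen_ball)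
    (fun x hx => Set.mem_iUnion.2 ⟨⟨x, hx⟩, Metric.mem_ball_self (hr _)⟩)
  obtain ⟨f, hf⟩ := SmoothPartitionOfUnity.exists_isSubordinate
    (modelWithCornersSelf ℝ (EuclideanSpace ℝ (Fin d))) hcomp.isClosed
    (fun i : s => Metric.ball ((i : closure (Ω : Set (EuclideanSpace ℝ (Fin d)))) :
      EuclideanSpace ℝ (Fin d)) (r i)) (fun _ => Metric.isOpen_ball)
    (fun x hx => by
      obtain ⟨i, hi, hxi⟩ := Set.mem_iUnion₂.1 (hs hx)
      exact Set.mem_iUnion.2 ⟨⟨i, hi⟩, hxi⟩)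
  refine ⟨s, fun i => f i, fun i => (f i).contMDiff.contDiff, fun i => ?_, fun x hx => ?_,
    fun i => ⟨v i, t₀ i, ht₀ i, fun y hy hyi => H i y hy (hf i hyi)⟩⟩
  · exact (isCompact_closedBall _ _).of_isClosed_subset (isClosed_tsupport _)
      ((hf i).trans Metric.ball_subset_closedBall)
  · rw [← finsum_eq_sum_of_fintype]
    exact f.sum_eq_one hx

end

/-! ### Weak gradients and test functions -/

section

open scoped ContDiff

variable {d : ℕ}

/-- Integration by parts for smooth functions one of which has compact support. -/
lemma integral_smul_gradient_eq_neg {f g : EuclideanSpace ℝ (Fin d) → ℝ} (hf : ContDiff ℝ ∞ f)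
    (hg : ContDiff ℝ ∞ g) (hfc : HasCompactSupport f) :
    ∫ x, f x • gradient g x = - ∫ x, g x • gradient f x := by
  have h1 : Integrable (fun x => f x • gradient g x) :=
    (hf.continuous.smul hg.continuous_gradient).integrable_of_hasCompactSupport hfc.smul_right
  have h2 : Integrable (fun x => g x • gradient f x) :=
    (hg.continuous.smul hf.continuous_gradient).integrable_of_hasCompactSupport
      hfc.gradient.smul_left
  have h3 : Integrable (fun x => f x * g x) :=
    (hf.continuous.mul hg.continuous).integrable_of_hasCompactSupport hfc.mul_right
  refine ext_inner_right ℝ fun v => ?_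
  rw [inner_neg_left, real_inner_comm, ← integral_inner h1, real_inner_comm, ← integral_inner h2]
  simp only [real_inner_smul_right, inner_gradient_right, conj_trivial]
  have hv1 : Integrable (fun x => f x * fderiv ℝ g x v) := by
    simpa only [real_inner_smul_left, inner_gradient_left] using h1.inner_const (𝕜 := ℝ) v
  have hv2 : Integrable (fun x => g x * fderiv ℝ f x v) := by
    simpa only [real_inner_smul_left, inner_gradient_left] using h2.inner_const (𝕜 := ℝ) v
  rw [integral_mul_fderiv_eq_neg_fderiv_mul_of_integrable (hv2.congr (.of_forall fun x => mul_comm _ _))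
    hv1 h3 (fun x _ => hf.differentiable (by simp) x) (fun x _ => hg.differentiable (by simp) x)]
  simp only [mul_comm]

section weakGradient

variable {Ω : Opens (EuclideanSpace ℝ (Fin d))}

lemma TestFunction.eq_zero_of_notMem (ψ : 𝓓(Ω, ℝ)) {x : EuclideanSpace ℝ (Fin d)} (hx : x ∉ Ω) :
    ψ x = 0 :=
  image_eq_zero_of_notMem_tsupport fun h => hx (ψ.tsupport_subset h)

lemma TestFunction.gradient_eq_zero_of_notMem (ψ : 𝓓(Ω, ℝ)) {x : EuclideanSpace ℝ (Fin d)}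
    (hx : x ∉ Ω) : gradient ψ x = 0 :=
  image_eq_zero_of_notMem_tsupport fun h => hx (ψ.tsupport_subset (tsupport_gradient_subset h))

lemma TestFunction.memLp_gradient (ψ : 𝓓(Ω, ℝ)) (p : ℝ≥0∞) : MemLp (gradient ψ) p volume :=
  ψ.contDiff.continuous_gradient.memLp_of_hasCompactSupport ψ.hasCompactSupport.gradient

lemma MeasureTheory.LocallyIntegrableOn.integrableOn_smul_of_tsupport_subset {F : Type*}
    [NormedAddCommGroup F] [NormedSpace ℝ F] {f : EuclideanSpace ℝ (Fin d) → F}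
    (hf : LocallyIntegrableOn f (Ω : Set (EuclideanSpace ℝ (Fin d))))
    {g : EuclideanSpace ℝ (Fin d) → ℝ} (hg : Continuous g) (hgc : HasCompactSupport g)
    (hgΩ : tsupport g ⊆ Ω) : IntegrableOn (fun x => g x • f x) Ω := by
  refine IntegrableOn.of_forall_sdiff_eq_zero
    ((hf.integrableOn_compact_subset hgΩ hgc).continuousOn_smul hg.continuousOn hgc)
    Ω.isOpen.measurableSet fun x hx => ?_
  rw [image_eq_zero_of_notMem_tsupport hx.2, zero_smul]

lemma MeasureTheory.LocallyIntegrableOn.integrableOn_smul_of_tsupport_subset' {F : Type*}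
    [NormedAddCommGroup F] [NormedSpace ℝ F] [SecondCountableTopology F]
    {f : EuclideanSpace ℝ (Fin d) → ℝ}
    (hf : LocallyIntegrableOn f (Ω : Set (EuclideanSpace ℝ (Fin d))))
    {g : EuclideanSpace ℝ (Fin d) → F} (hg : Continuous g) (hgc : HasCompactSupport g)
    (hgΩ : tsupport g ⊆ Ω) : IntegrableOn (fun x => f x • g x) Ω := by
  refine IntegrableOn.of_forall_sdiff_eq_zero
    ((hf.integrableOn_compact_subset hgΩ hgc).smul_continuousOn hg.continuousOn hgc)
    Ω.isOpen.measurableSet fun x hx => ?_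
  rw [image_eq_zero_of_notMem_tsupport hx.2, smul_zero]

lemma TestFunction.isWeakGradient (ψ : 𝓓(Ω, ℝ)) : IsWeakGradient Ω ψ (gradient ψ) := by
  refine ⟨ψ.continuous.locallyIntegrable.locallyIntegrableOn _,
    ψ.contDiff.continuous_gradient.locallyIntegrable.locallyIntegrableOn _, fun χ => ?_⟩
  rw [setIntegral_eq_integral_of_forall_compl_eq_zero fun x hx => by
      rw [ψ.eq_zero_of_notMem hx, zero_smul],
    setIntegral_eq_integral_of_forall_compl_eq_zero fun x hx => by
      rw [ψ.gradient_eq_zero_of_notMem hx, smul_zero]]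
  exact integral_smul_gradient_eq_neg ψ.contDiff χ.contDiff ψ.hasCompactSupport

lemma IsWeakGradient.sub {u w : EuclideanSpace ℝ (Fin d) → ℝ}
    {G H : EuclideanSpace ℝ (Fin d) → EuclideanSpace ℝ (Fin d)} (hu : IsWeakGradient Ω u G)
    (hw : IsWeakGradient Ω w H) : IsWeakGradient Ω (u - w) (G - H) := by
  refine ⟨hu.1.sub hw.1, hu.2.1.sub hw.2.1, fun ψ => ?_⟩
  have hg : tsupport (gradient ψ) ⊆ Ω := tsupport_gradient_subset.trans ψ.tsupport_subset
  simp only [Pi.sub_apply, sub_smul, smul_sub]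
  rw [integral_sub
      (hu.1.integrableOn_smul_of_tsupport_subset' ψ.contDiff.continuous_gradient
        ψ.hasCompactSupport.gradient hg)
      (hw.1.integrableOn_smul_of_tsupport_subset' ψ.contDiff.continuous_gradient
        ψ.hasCompactSupport.gradient hg),
    integral_sub
      (hu.2.1.integrableOn_smul_of_tsupport_subset ψ.continuous ψ.hasCompactSupport
        ψ.tsupport_subset)
      (hw.2.1.integrableOn_smul_of_tsupport_subset ψ.continuous ψ.hasCompactSupport
        ψ.tsupport_subset), hu.2.2 ψ, hw.2.2 ψ]
  abel

/-- The weak gradient is unique almost everywhere. -/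
lemma IsWeakGradient.ae_eq {w : EuclideanSpace ℝ (Fin d) → ℝ}
    {G H : EuclideanSpace ℝ (Fin d) → EuclideanSpace ℝ (Fin d)} (hG : IsWeakGradient Ω w G)
    (hH : IsWeakGradient Ω w H) :
    G =ᵐ[volume.restrict (Ω : Set (EuclideanSpace ℝ (Fin d)))] H := by
  have h := Ω.isOpen.ae_eq_zero_of_integral_contDiff_smul_eq_zero (μ := volume)
    (hG.2.1.sub hH.2.1) fun g h1 h2 h3 => by
      rw [← setIntegral_eq_integral_of_forall_compl_eq_zero
        (s := (Ω : Set (EuclideanSpace ℝ (Fin d)))) fun x hx => by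
          rw [image_eq_zero_of_notMem_tsupport fun h => hx (h3 h), zero_smul]]
      simp only [Pi.sub_apply, smul_sub]
      rw [integral_sub (hG.2.1.integrableOn_smul_of_tsupport_subset h1.continuous h2 h3)
        (hH.2.1.integrableOn_smul_of_tsupport_subset h1.continuous h2 h3)]
      have e1 := hG.2.2 ⟨g, h1, h2, h3⟩
      have e2 := hH.2.2 ⟨g, h1, h2, h3⟩
      exact sub_eq_zero.2 (neg_injective (e1.symm.trans e2))
  filter_upwards [(ae_restrict_iff' Ω.isOpen.measurableSet).2 h] with x hx
  exact sub_eq_zero.1 hx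

lemma isWeakGradient_weakGradient {w : EuclideanSpace ℝ (Fin d) → ℝ}
    (h : ∃ G, IsWeakGradient Ω w G) : IsWeakGradient Ω w (weakGradient Ω w) := by
  rw [weakGradient, dif_pos h]
  exact h.choose_spec

lemma IsWeakGradient.weakGradient_ae_eq {w : EuclideanSpace ℝ (Fin d) → ℝ}
    {G : EuclideanSpace ℝ (Fin d) → EuclideanSpace ℝ (Fin d)} (hG : IsWeakGradient Ω w G) :
    weakGradient Ω w =ᵐ[volume.restrict (Ω : Set (EuclideanSpace ℝ (Fin d)))] G :=
  (isWeakGradient_weakGradient ⟨G, hG⟩).ae_eq hG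

lemma weakGradient_sub_testFunction_ae_eq {w : EuclideanSpace ℝ (Fin d) → ℝ}
    (h : ∃ G, IsWeakGradient Ω w G) (ψ : 𝓓(Ω, ℝ)) :
    weakGradient Ω (w - ⇑ψ) =ᵐ[volume.restrict (Ω : Set (EuclideanSpace ℝ (Fin d)))]
      weakGradient Ω w - gradient ψ :=
  ((isWeakGradient_weakGradient h).sub ψ.isWeakGradient).weakGradient_ae_eq

lemma TestFunction.weakGradient_ae_eq (ψ : 𝓓(Ω, ℝ)) :
    weakGradient Ω ψ =ᵐ[volume.restrict (Ω : Set (EuclideanSpace ℝ (Fin d)))] gradient ψ :=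
  ψ.isWeakGradient.weakGradient_ae_eq

lemma TestFunction.mem_sobolevH10 (ψ : 𝓓(Ω, ℝ)) : ⇑ψ ∈ sobolevH10 Ω := by
  refine ⟨⟨(ψ.continuous.memLp_of_hasCompactSupport ψ.hasCompactSupport).restrict _,
    ⟨_, ψ.isWeakGradient⟩, ((ψ.memLp_gradient 2).restrict _).ae_eq ψ.weakGradient_ae_eq.symm⟩,
    fun ε hε => ⟨ψ, ?_⟩⟩
  rw [sobolevH1Norm, eLpNorm_congr_ae
    (weakGradient_sub_testFunction_ae_eq ⟨_, ψ.isWeakGradient⟩ ψ)]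
  rw [eLpNorm_congr_ae (ψ.weakGradient_ae_eq.sub (EventuallyEq.refl _ (gradient ψ)))]
  simpa using hε

end weakGradient

end

/-! ### Smooth truncation of functions in `H¹₀` -/

section

open scoped ContDiff

variable {d : ℕ}

noncomputable section

/-- A smooth bounded truncation, which approaches the identity as `c → 0`. -/
def arctanTrunc (c s : ℝ) : ℝ := c⁻¹ * Real.arctan (c * s)

/-- The derivative of `arctanTrunc c`. -/
def arctanTruncDeriv (c s : ℝ) : ℝ := (1 + (c * s) ^ 2)⁻¹

end

lemma hasDerivAt_arctanTrunc {c : ℝ} (hc : c ≠ 0) (s : ℝ) :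
    HasDerivAt (arctanTrunc c) (arctanTruncDeriv c s) s := by
  have h := (((hasDerivAt_id s).const_mul c).arctan).const_mul c⁻¹
  refine h.congr_deriv ?_
  simp only [arctanTruncDeriv, id]
  field_simp

lemma contDiff_arctanTrunc (c : ℝ) : ContDiff ℝ ∞ (arctanTrunc c) :=
  contDiff_const.mul (Real.contDiff_arctan.comp (contDiff_const.mul contDiff_id))

lemma arctanTrunc_zero (c : ℝ) : arctanTrunc c 0 = 0 := by simp [arctanTrunc]

lemma continuous_arctanTruncDeriv (c : ℝ) : Continuous (arctanTruncDeriv c) :=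
  Continuous.inv₀ (by fun_prop) fun s => by positivity

lemma arctanTruncDeriv_pos (c s : ℝ) : 0 < arctanTruncDeriv c s := by
  unfold arctanTruncDeriv; positivity

lemma arctanTruncDeriv_le_one (c s : ℝ) : arctanTruncDeriv c s ≤ 1 :=
  inv_le_one_of_one_le₀ (by nlinarith [sq_nonneg (c * s)])

lemma abs_arctanTruncDeriv_le_one (c s : ℝ) : |arctanTruncDeriv c s| ≤ 1 := by
  rw [abs_of_pos (arctanTruncDeriv_pos c s)]
  exact arctanTruncDeriv_le_one c s

lemma abs_arctanTrunc_le (c s : ℝ) : |arctanTrunc c s| ≤ |c⁻¹| * (Real.pi / 2) := by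
  rw [arctanTrunc, abs_mul]
  exact mul_le_mul_of_nonneg_left (abs_le.2 ⟨(Real.neg_pi_div_two_lt_arctan _).le,
    (Real.arctan_lt_pi_div_two _).le⟩) (abs_nonneg _)

lemma abs_arctanTrunc_sub_le {c : ℝ} (hc : c ≠ 0) (s t : ℝ) :
    |arctanTrunc c s - arctanTrunc c t| ≤ |s - t| := by
  have h := Convex.norm_image_sub_le_of_norm_hasDerivWithin_le (C := 1)
    (fun x _ => (hasDerivAt_arctanTrunc hc x).hasDerivWithinAt)
    (fun x _ => abs_arctanTruncDeriv_le_one c x) convex_univ (Set.mem_univ t) (Set.mem_univ s)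
  simpa using h

lemma abs_arctanTruncDeriv_sub_le (c s t : ℝ) :
    |arctanTruncDeriv c s - arctanTruncDeriv c t| ≤ |c| * |s - t| := by
  unfold arctanTruncDeriv
  set a := c * s with ha
  set b := c * t with hb
  have hab : c * (s - t) = a - b := by rw [ha, hb]; ring
  rw [← abs_mul, hab, inv_sub_inv (by positivity) (by positivity), abs_div,
    abs_of_pos (by positivity : 0 < (1 + a ^ 2) * (1 + b ^ 2)), div_le_iff₀ (by positivity)]
  have h1 : 1 + b ^ 2 - (1 + a ^ 2) = -((a - b) * (a + b)) := by ring
  rw [h1, abs_neg, abs_mul]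
  -- What remains is `|a + b| ≤ (1 + a ^ 2) * (1 + b ^ 2)`.
  refine mul_le_mul_of_nonneg_left (abs_le.2 ⟨?_, ?_⟩) (abs_nonneg _)
  · nlinarith [sq_nonneg (a + 1), sq_nonneg (b + 1), mul_nonneg (sq_nonneg a) (sq_nonneg b)]
  · nlinarith [sq_nonneg (a - 1), sq_nonneg (b - 1), mul_nonneg (sq_nonneg a) (sq_nonneg b)]

lemma tendsto_arctanTruncDeriv (s : ℝ) :
    Tendsto (fun c => arctanTruncDeriv c s) (𝓝 0) (𝓝 1) := by
  have h : Continuous fun c => arctanTruncDeriv c s :=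
    Continuous.inv₀ (by fun_prop) fun c => by positivity
  simpa [arctanTruncDeriv] using h.tendsto 0

lemma tendsto_integral_of_enorm_sub_le {X F F' : Type*} [MeasurableSpace X] {μ : Measure X}
    [NormedAddCommGroup F] [NormedSpace ℝ F] [NormedAddCommGroup F']
    {H : X → F} {Hn : ℕ → X → F} (hH : AEStronglyMeasurable H μ) (hHn : ∀ n, Integrable (Hn n) μ)
    {f : X → F'} {fn : ℕ → X → F'} {M : ℝ}
    (hle : ∀ n x, ‖Hn n x - H x‖ ≤ M * ‖fn n x - f x‖)
    (hf : Tendsto (fun n => eLpNorm (fn n - f) 1 μ) atTop (𝓝 0)) :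
    Tendsto (fun n => ∫ x, Hn n x ∂μ) atTop (𝓝 (∫ x, H x ∂μ)) := by
  refine tendsto_integral_of_L1 H hH (.of_forall hHn) ?_
  have h0 := ENNReal.Tendsto.const_mul (a := ENNReal.ofReal M) hf (Or.inr ENNReal.ofReal_ne_top)
  rw [mul_zero] at h0
  refine tendsto_of_tendsto_of_tendsto_of_le_of_le tendsto_const_nhds h0 (fun _ => zero_le)
    fun n => ?_
  rw [eLpNorm_one_eq_lintegral_enorm, ← lintegral_const_mul' _ _ ENNReal.ofReal_ne_top]
  refine lintegral_mono fun x => ?_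
  rw [← ofReal_norm, ← ofReal_norm, ← ENNReal.ofReal_mul' (norm_nonneg _)]
  exact ENNReal.ofReal_le_ofReal (hle n x)

lemma tendsto_eLpNorm_one_of_tendsto_eLpNorm_two {X F : Type*} [MeasurableSpace X] {μ : Measure X}
    [IsFiniteMeasure μ] [NormedAddCommGroup F] {f : ℕ → X → F}
    (hfm : ∀ n, AEStronglyMeasurable (f n) μ)
    (hf : Tendsto (fun n => eLpNorm (f n) 2 μ) atTop (𝓝 0)) :
    Tendsto (fun n => eLpNorm (f n) 1 μ) atTop (𝓝 0) := by
  have hm : μ Set.univ ^ (1 / (1 : ℝ≥0∞).toReal - 1 / (2 : ℝ≥0∞).toReal) ≠ ⊤ :=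
    ENNReal.rpow_ne_top_of_nonneg (by norm_num) (measure_ne_top _ _)
  have h0 := ENNReal.Tendsto.mul_const hf (Or.inr hm)
  rw [zero_mul] at h0
  exact tendsto_of_tendsto_of_tendsto_of_le_of_le tendsto_const_nhds h0 (fun _ => zero_le)
    fun n => eLpNorm_le_eLpNorm_mul_rpow_measure_univ one_le_two (hfm n)

/-- The difference is `T'(v n) (H n - G) + (T'(v n) - T'(w)) G`. The first term is controlled by
`|T'| ≤ 1`, the second by the Lipschitz bound on `T'` and Hölder's inequality, whence convergence in
`L¹` only. -/
lemma tendsto_eLpNorm_arctanTruncDeriv_smul {X F : Type*} [MeasurableSpace X] {μ : Measure X}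
    [IsFiniteMeasure μ] [NormedAddCommGroup F] [NormedSpace ℝ F] (c : ℝ) {w : X → ℝ} {v : ℕ → X → ℝ}
    {G : X → F} {H : ℕ → X → F} (hw : AEStronglyMeasurable w μ) (hG : MemLp G 2 μ)
    (hv : ∀ n, AEStronglyMeasurable (v n) μ) (hH : ∀ n, AEStronglyMeasurable (H n) μ)
    (hvw : Tendsto (fun n => eLpNorm (v n - w) 2 μ) atTop (𝓝 0))
    (hHG : Tendsto (fun n => eLpNorm (H n - G) 2 μ) atTop (𝓝 0)) :
    Tendsto (fun n => eLpNorm ((fun x => arctanTruncDeriv c (v n x) • H n x) -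
      fun x => arctanTruncDeriv c (w x) • G x) 1 μ) atTop (𝓝 0) := by
  have h1 := tendsto_eLpNorm_one_of_tendsto_eLpNorm_two (fun n => (hH n).sub hG.1) hHG
  have h2 := ENNReal.Tendsto.const_mul (a := ENNReal.ofReal |c|)
    (ENNReal.Tendsto.mul_const (b := eLpNorm G 2 μ) hvw (Or.inr hG.2.ne))
    (Or.inr ENNReal.ofReal_ne_top)
  have h0 := h1.add h2
  rw [zero_mul, mul_zero, add_zero] at h0
  refine tendsto_of_tendsto_of_tendsto_of_le_of_le tendsto_const_nhds h0 (fun _ => zero_le)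
    fun n => ?_
  have hT'v : AEStronglyMeasurable (fun x => arctanTruncDeriv c (v n x)) μ :=
    (continuous_arctanTruncDeriv c).comp_aestronglyMeasurable (hv n)
  have hT'w : AEStronglyMeasurable (fun x => arctanTruncDeriv c (w x)) μ :=
    (continuous_arctanTruncDeriv c).comp_aestronglyMeasurable hw
  have hsplit : ((fun x => arctanTruncDeriv c (v n x) • H n x) -
      fun x => arctanTruncDeriv c (w x) • G x) =
      (fun x => arctanTruncDeriv c (v n x)) • (H n - G) +
      ((fun x => arctanTruncDeriv c (v n x)) - fun x => arctanTruncDeriv c (w x)) • G := by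
    ext1 x
    simp only [Pi.sub_apply, Pi.add_apply, Pi.smul_apply', smul_sub, sub_smul]
    abel
  rw [hsplit]
  refine (eLpNorm_add_le (hT'v.smul ((hH n).sub hG.1)) ((hT'v.sub hT'w).smul hG.1)
    le_rfl).trans (add_le_add ?_ ?_)
  · refine eLpNorm_mono fun x => ?_
    rw [Pi.smul_apply', norm_smul]
    exact mul_le_of_le_one_left (norm_nonneg _) (abs_arctanTruncDeriv_le_one c _)
  · refine (eLpNorm_smul_le_mul_eLpNorm (p := 2) (q := 2) (r := 1) hG.1
      (hT'v.sub hT'w)).trans ?_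
    rw [← mul_assoc]
    refine mul_le_mul_left (eLpNorm_le_mul_eLpNorm_of_ae_le_mul (.of_forall fun x => ?_) 2) _
    exact abs_arctanTruncDeriv_sub_le c _ _

lemma integrable_smul_of_hasCompactSupport_left {F : Type*} [NormedAddCommGroup F] [NormedSpace ℝ F]
    {f : EuclideanSpace ℝ (Fin d) → ℝ} {g : EuclideanSpace ℝ (Fin d) → F} (hf : Continuous f)
    (hg : Continuous g) (hfc : HasCompactSupport f) : Integrable (fun x => f x • g x) :=
  (hf.smul hg).integrable_of_hasCompactSupport hfc.smul_right

lemma integrable_smul_of_hasCompactSupport_right {F : Type*} [NormedAddCommGroup F]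
    [NormedSpace ℝ F] {f : EuclideanSpace ℝ (Fin d) → ℝ} {g : EuclideanSpace ℝ (Fin d) → F}
    (hf : Continuous f) (hg : Continuous g) (hgc : HasCompactSupport g) :
    Integrable (fun x => f x • g x) :=
  (hf.smul hg).integrable_of_hasCompactSupport hgc.smul_left

/-- The smooth truncation of an `H¹₀` function, extended by zero, has the expected weak gradient on
the whole space. -/
lemma hasGlobalWeakGradient_arctanTrunc {Ω : Opens (EuclideanSpace ℝ (Fin d))}
    (hΩ : volume (Ω : Set (EuclideanSpace ℝ (Fin d))) < ⊤)
    {w : EuclideanSpace ℝ (Fin d) → ℝ} (hw : w ∈ sobolevH10 Ω) {c : ℝ} (hc : c ≠ 0) :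
    HasGlobalWeakGradient
      ((Ω : Set (EuclideanSpace ℝ (Fin d))).indicator fun x => arctanTrunc c (w x))
      ((Ω : Set (EuclideanSpace ℝ (Fin d))).indicator fun x =>
        arctanTruncDeriv c (w x) • weakGradient Ω w x) := by
  set S : Set (EuclideanSpace ℝ (Fin d)) := (Ω : Set (EuclideanSpace ℝ (Fin d))) with hS
  set μ := volume.restrict S with hμ
  set G := weakGradient Ω w with hG
  have hSm : MeasurableSet S := Ω.isOpen.measurableSet
  have : IsFiniteMeasure μ := ⟨by rwa [hμ, Measure.restrict_apply_univ]⟩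
  obtain ⟨⟨hw2, hwG, hG2⟩, happ⟩ := hw
  have hTw : AEStronglyMeasurable (fun x => arctanTrunc c (w x)) μ :=
    (contDiff_arctanTrunc c).continuous.comp_aestronglyMeasurable hw2.1
  have hT'w : AEStronglyMeasurable (fun x => arctanTruncDeriv c (w x)) μ :=
    (continuous_arctanTruncDeriv c).comp_aestronglyMeasurable hw2.1
  have hG1 : Integrable G μ := hG2.integrable one_le_two
  have hui : Integrable (fun x => arctanTrunc c (w x)) μ :=
    Integrable.of_bound hTw _ (.of_forall fun x => abs_arctanTrunc_le c (w x))
  have hGi : Integrable (fun x => arctanTruncDeriv c (w x) • G x) μ :=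
    hG1.bdd_smul 1 hT'w (.of_forall fun x => abs_arctanTruncDeriv_le_one c (w x))
  refine ⟨(integrable_indicator_iff hSm).2 hui, (integrable_indicator_iff hSm).2 hGi,
    fun ψ hψ hψc => ?_⟩
  have hsw : (fun x => ψ x • S.indicator (fun x => arctanTruncDeriv c (w x) • G x) x) =
      S.indicator fun x => ψ x • arctanTruncDeriv c (w x) • G x := by
    ext1 x
    by_cases hx : x ∈ S <;> simp [hx]
  have hsw' : (fun x => S.indicator (fun x => arctanTrunc c (w x)) x • gradient ψ x) =
      S.indicator fun x => arctanTrunc c (w x) • gradient ψ x := by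
    ext1 x
    by_cases hx : x ∈ S <;> simp [hx]
  rw [hsw, hsw', integral_indicator hSm, integral_indicator hSm]
  -- Here `H¹₀` enters: `ψ` need not vanish on the boundary, but the approximants `χ n` do, so
  -- integration by parts holds for them without boundary terms and passes to the limit.
  have hseq : ∀ n : ℕ, ∃ χ : 𝓓(Ω, ℝ), sobolevH1Norm Ω (w - ⇑χ) < ENNReal.ofReal (1 / (n + 1)) :=
    fun n => happ _ (by positivity)
  choose χ hχ using hseq
  have hε : Tendsto (fun n : ℕ => ENNReal.ofReal (1 / ((n : ℝ) + 1))) atTop (𝓝 0) := by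
    simpa using ENNReal.tendsto_ofReal tendsto_one_div_add_atTop_nhds_zero_nat
  have hχw : Tendsto (fun n => eLpNorm (⇑(χ n) - w) 2 μ) atTop (𝓝 0) := by
    refine tendsto_of_tendsto_of_tendsto_of_le_of_le tendsto_const_nhds hε (fun _ => zero_le)
      fun n => ?_
    rw [eLpNorm_sub_comm]
    exact le_self_add.trans (hχ n).le
  have hχG : Tendsto (fun n => eLpNorm (gradient (χ n) - G) 2 μ) atTop (𝓝 0) := by
    refine tendsto_of_tendsto_of_tendsto_of_le_of_le tendsto_const_nhds hε (fun _ => zero_le)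
      fun n => ?_
    rw [eLpNorm_sub_comm, ← eLpNorm_congr_ae (weakGradient_sub_testFunction_ae_eq hwG (χ n))]
    exact le_add_self.trans (hχ n).le
  have hχm : ∀ n, AEStronglyMeasurable (χ n) μ := fun n => (χ n).continuous.aestronglyMeasurable
  have hlim1 := tendsto_eLpNorm_one_of_tendsto_eLpNorm_two (fun n => (hχm n).sub hw2.1) hχw
  have hlim2 := tendsto_eLpNorm_arctanTruncDeriv_smul c hw2.1 hG2 hχm (fun n =>
    (χ n).contDiff.continuous_gradient.aestronglyMeasurable) hχw hχG
  obtain ⟨M, hM⟩ := hψ.continuous.bounded_above_of_compact_support hψc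
  obtain ⟨M', hM'⟩ := hψ.continuous_gradient.bounded_above_of_compact_support hψc.gradient
  have hIL : ∀ n, Integrable (fun x => arctanTrunc c (χ n x) • gradient ψ x) := fun n =>
    integrable_smul_of_hasCompactSupport_right
      ((contDiff_arctanTrunc c).continuous.comp (χ n).continuous) hψ.continuous_gradient
      hψc.gradient
  have hIR : ∀ n, Integrable (fun x => ψ x • arctanTruncDeriv c (χ n x) • gradient (χ n) x) :=
    fun n => integrable_smul_of_hasCompactSupport_left hψ.continuous
      (((continuous_arctanTruncDeriv c).comp (χ n).continuous).smul
        (χ n).contDiff.continuous_gradient) hψc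
  have hL : Tendsto (fun n => ∫ x, arctanTrunc c (χ n x) • gradient ψ x ∂μ) atTop
      (𝓝 (∫ x, arctanTrunc c (w x) • gradient ψ x ∂μ)) := by
    refine tendsto_integral_of_enorm_sub_le (f := w) (fn := fun n => χ n) (M := M')
      (hTw.smul hψ.continuous_gradient.aestronglyMeasurable) (fun n => ?_) (fun n x => ?_) hlim1
    · exact (hIL n).restrict
    · rw [← sub_smul, norm_smul, mul_comm]
      exact mul_le_mul (hM' x) (abs_arctanTrunc_sub_le hc _ _) (norm_nonneg _)
        ((norm_nonneg _).trans (hM' x))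
  have hR : Tendsto (fun n => ∫ x, ψ x • arctanTruncDeriv c (χ n x) • gradient (χ n) x ∂μ) atTop
      (𝓝 (∫ x, ψ x • arctanTruncDeriv c (w x) • G x ∂μ)) := by
    refine tendsto_integral_of_enorm_sub_le (f := fun x => arctanTruncDeriv c (w x) • G x)
      (fn := fun n x => arctanTruncDeriv c (χ n x) • gradient (χ n) x) (M := M)
      (hψ.continuous.aestronglyMeasurable.smul (hT'w.smul hG2.1)) (fun n => ?_) (fun n x => ?_) hlim2
    · exact (hIR n).restrict
    · rw [← smul_sub, norm_smul]
      exact mul_le_mul_of_nonneg_right (hM x) (norm_nonneg _)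
  refine tendsto_nhds_unique (hL.congr fun n => ?_) hR.neg
  have hcd : ContDiff ℝ ∞ fun x => arctanTrunc c (χ n x) :=
    (contDiff_arctanTrunc c).comp (χ n).contDiff
  have hgrad : ∀ x, gradient (fun x => arctanTrunc c (χ n x)) x =
      arctanTruncDeriv c (χ n x) • gradient (χ n) x := fun x =>
    (HasDerivAt.comp_hasGradientAt (f := χ n) (hasDerivAt_arctanTrunc hc _)
      ((χ n).contDiff.hasGradientAt x)).gradient
  have hibp := integral_smul_gradient_eq_neg hcd hψ
    ((χ n).hasCompactSupport.comp_left (arctanTrunc_zero c))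
  simp only [hgrad] at hibp
  rw [hμ, setIntegral_eq_integral_of_forall_compl_eq_zero fun x hx => by
      rw [(χ n).eq_zero_of_notMem hx, arctanTrunc_zero, zero_smul], hibp,
    setIntegral_eq_integral_of_forall_compl_eq_zero fun x hx => by
      rw [(χ n).gradient_eq_zero_of_notMem hx, smul_zero, smul_zero]]

end

/-! ### Cutoffs, the space `E_φ` and the norm of `V` -/

section

open scoped ContDiff

variable {d : ℕ} {Ω : Opens (EuclideanSpace ℝ (Fin d))}
  {φ : EuclideanSpace ℝ (Fin d) → ℝ}

lemma modular_indicator {Φ : EuclideanSpace ℝ (Fin d) → ℝ} (hΦ : Φ 0 = 0)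
    {S : Set (EuclideanSpace ℝ (Fin d))} (hS : MeasurableSet S)
    (F : EuclideanSpace ℝ (Fin d) → EuclideanSpace ℝ (Fin d)) :
    modular Φ volume (S.indicator F) = modular Φ (volume.restrict S) F := by
  unfold modular
  rw [← lintegral_indicator hS]
  refine lintegral_congr fun x => ?_
  by_cases hx : x ∈ S <;> simp [hx, hΦ]

/-- The product rule for a weak gradient and a smooth cutoff. -/
lemma HasGlobalWeakGradient.smul_left {u : EuclideanSpace ℝ (Fin d) → ℝ}
    {G : EuclideanSpace ℝ (Fin d) → EuclideanSpace ℝ (Fin d)} (h : HasGlobalWeakGradient u G)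
    {η : EuclideanSpace ℝ (Fin d) → ℝ} (hη : ContDiff ℝ ∞ η) (hηc : HasCompactSupport η) :
    HasGlobalWeakGradient (fun x => η x * u x) (fun x => η x • G x + u x • gradient η x) := by
  obtain ⟨M, hM⟩ := hη.continuous.bounded_above_of_compact_support hηc
  obtain ⟨M', hM'⟩ := hη.continuous_gradient.bounded_above_of_compact_support hηc.gradient
  have h1 : Integrable (fun x => η x * u x) :=
    h.integrable.bdd_mul hη.continuous.aestronglyMeasurable (.of_forall hM)
  have h2 : Integrable (fun x => η x • G x) :=
    h.integrable_grad.bdd_smul M hη.continuous.aestronglyMeasurable (.of_forall hM)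
  have h3 : Integrable (fun x => u x • gradient η x) :=
    h.integrable.smul_bdd M' hη.continuous_gradient.aestronglyMeasurable (.of_forall hM')
  refine ⟨h1, h2.add h3, fun ψ hψ hψc => ?_⟩
  obtain ⟨B, hB⟩ := hψ.continuous.bounded_above_of_compact_support hψc
  obtain ⟨B', hB'⟩ := hψ.continuous_gradient.bounded_above_of_compact_support hψc.gradient
  -- Testing with `η ψ` moves the cutoff onto `u`.
  have key := h.integral_eq (fun x => η x * ψ x) (hη.mul hψ) hηc.mul_right
  have hgrad : ∀ x, gradient (fun x => η x * ψ x) x = η x • gradient ψ x + ψ x • gradient η x :=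
    fun x => ((hη.hasGradientAt x).mul' (hψ.hasGradientAt x)).gradient
  have i1 : Integrable (fun x => (η x * u x) • gradient ψ x) :=
    h1.smul_bdd B' hψ.continuous_gradient.aestronglyMeasurable (.of_forall hB')
  have i2 : Integrable (fun x => ψ x • u x • gradient η x) :=
    h3.bdd_smul B hψ.continuous.aestronglyMeasurable (.of_forall hB)
  have i3 : Integrable (fun x => ψ x • η x • G x) :=
    h2.bdd_smul B hψ.continuous.aestronglyMeasurable (.of_forall hB)
  have e1 : ∫ x, u x • gradient (fun x => η x * ψ x) x =
      (∫ x, (η x * u x) • gradient ψ x) + ∫ x, ψ x • u x • gradient η x := by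
    rw [← integral_add i1 i2]
    refine integral_congr_ae (.of_forall fun x => ?_)
    simp only [hgrad, smul_add, smul_smul]
    ring_nf
  have e2 : ∫ x, (η x * ψ x) • G x = ∫ x, ψ x • η x • G x := by
    refine integral_congr_ae (.of_forall fun x => ?_)
    simp only [smul_smul]
    ring_nf
  rw [e1, e2] at key
  simp only [smul_add]
  rw [integral_add i3 i2, neg_add, ← key]
  abel

lemma orliczModular_eq_modular (F : EuclideanSpace ℝ (Fin d) → EuclideanSpace ℝ (Fin d)) :
    orliczModular φ Ω F = modular φ (volume.restrict (Ω : Set (EuclideanSpace ℝ (Fin d)))) F :=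
  rfl

lemma modular_add_norm_sq (hφ : IsConvexGauge φ) {μ : Measure (EuclideanSpace ℝ (Fin d))}
    {F : EuclideanSpace ℝ (Fin d) → EuclideanSpace ℝ (Fin d)} (hF : AEStronglyMeasurable F μ) :
    modular (fun ξ => φ ξ + ‖ξ‖ ^ 2) μ F = modular φ μ F + eLpNorm F 2 μ ^ 2 := by
  have h2 : eLpNorm F 2 μ ^ 2 = ∫⁻ x, ENNReal.ofReal (‖F x‖ ^ 2) ∂μ := by
    have := eLpNorm_nnreal_pow_eq_lintegral (f := F) (μ := μ) (p := 2) (by norm_num)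
    norm_num at this
    rw [this]
    refine lintegral_congr fun x => ?_
    rw [ENNReal.ofReal_pow (norm_nonneg _), ofReal_norm]
  rw [h2]
  unfold modular
  rw [← lintegral_add_left' (hφ.aemeasurable_comp hF)]
  exact lintegral_congr fun x => ENNReal.ofReal_add (hφ.nonneg _) (by positivity)

/-- The elements of `E_φ` have finite modulars. -/
lemma hasFiniteModulars_of_mem_orliczE (hφ : IsConvexGauge φ)
    (hΩ : volume (Ω : Set (EuclideanSpace ℝ (Fin d))) < ⊤)
    {ξ : EuclideanSpace ℝ (Fin d) → EuclideanSpace ℝ (Fin d)} (hξ : ξ ∈ orliczE φ Ω) :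
    HasFiniteModulars φ (volume.restrict (Ω : Set (EuclideanSpace ℝ (Fin d)))) ξ := fun c => by
  set μ := volume.restrict (Ω : Set (EuclideanSpace ℝ (Fin d)))
  have hc : 0 < |c| + 1 := by positivity
  -- At this distance `2 (|c| + 1) (ξ - b)` has modular at most `1`, the factor `2` being used up by
  -- midpoint convexity. The bounded part `b` has finite modulars because `Ω` has finite measure.
  obtain ⟨b, hbm, ⟨C, hC⟩, hlt⟩ := hξ.2 ((2 * (|c| + 1))⁻¹) (by positivity)
  obtain ⟨t, ⟨l, hl, hmod, rfl⟩, hlt⟩ := sInf_lt_iff.1 hlt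
  rw [ENNReal.ofReal_lt_ofReal_iff (by positivity), lt_inv_comm₀ hl (by positivity)] at hlt
  have hb : HasFiniteModulars φ μ b := by
    refine HasFiniteModulars.of_bounded (K := Set.univ) hφ ?_ (fun x hx => absurd trivial hx) hC
    rwa [Measure.restrict_apply_univ]
  refine (hφ.modular_smul_le (b := |c| + 1) ?_ ξ).trans_lt ?_
  · rw [abs_of_pos hc]; linarith
  have hsplit : (|c| + 1) • ξ = (|c| + 1) • b + (|c| + 1) • (ξ - b) := by
    rw [← smul_add, add_sub_cancel]
  rw [hsplit]
  refine (hφ.modular_add_le (hbm.aestronglyMeasurable.const_smul _) _).trans_lt ?_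
  rw [smul_smul, smul_smul]
  refine ENNReal.div_lt_top (ENNReal.add_lt_top.2 ⟨hb _, ?_⟩).ne (by norm_num)
  refine (hφ.modular_smul_le (b := l⁻¹) ?_ _).trans_lt (hmod.trans_lt ENNReal.one_lt_top)
  rw [abs_of_pos (by positivity : 0 < 2 * (|c| + 1)), abs_of_pos (by positivity : 0 < l⁻¹)]
  exact hlt.le

/-- A bound for the norm of `V` in terms of a modular. -/
lemma normV_le_of_modular_le (hφ : IsConvexGauge φ) {w : EuclideanSpace ℝ (Fin d) → ℝ}
    {l : ℝ} (hl : 0 < l)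
    (hm : AEStronglyMeasurable (weakGradient Ω w)
      (volume.restrict (Ω : Set (EuclideanSpace ℝ (Fin d)))))
    (h : modular (fun ξ => φ ξ + ‖ξ‖ ^ 2) (volume.restrict (Ω : Set (EuclideanSpace ℝ (Fin d))))
      (l⁻¹ • weakGradient Ω w) ≤ 1) :
    normV φ Ω w ≤ ENNReal.ofReal (2 * l) := by
  rw [modular_add_norm_sq hφ (hm.const_smul _)] at h
  rw [normV, two_mul, ENNReal.ofReal_add hl.le hl.le]
  refine add_le_add ?_ (sInf_le ⟨l, hl, le_self_add.trans h, rfl⟩)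
  have h2 : eLpNorm (l⁻¹ • weakGradient Ω w) 2
      (volume.restrict (Ω : Set (EuclideanSpace ℝ (Fin d)))) ≤ 1 := by
    have := le_add_self.trans h
    exact (pow_le_one_iff two_ne_zero).1 this
  have h3 : weakGradient Ω w = l • l⁻¹ • weakGradient Ω w := by
    rw [smul_smul, mul_inv_cancel₀ hl.ne', one_smul]
  rw [h3, eLpNorm_const_smul, Real.enorm_eq_ofReal hl.le]
  exact mul_le_of_le_one_right zero_le h2

lemma TestFunction.mem_spaceV (hφ : IsConvexGauge φ) (ψ : 𝓓(Ω, ℝ)) : ⇑ψ ∈ spaceV φ Ω := by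
  have hfin : HasFiniteModulars φ (volume.restrict (Ω : Set (EuclideanSpace ℝ (Fin d))))
      (gradient ψ) := by
    obtain ⟨C, hC⟩ := ψ.contDiff.continuous_gradient.bounded_above_of_compact_support
      ψ.hasCompactSupport.gradient
    exact HasFiniteModulars.of_bounded (K := tsupport (gradient ψ)) hφ
      ((Measure.restrict_apply_le _ _).trans_lt
        (ψ.hasCompactSupport.gradient.isCompact.measure_lt_top))
      (fun x hx => image_eq_zero_of_notMem_tsupport hx) hC
  have hmeas : Continuous (gradient ψ) := ψ.contDiff.continuous_gradient
  -- The classical gradient is bounded and equals the weak one almost everywhere, so it serves as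
  -- its own approximant.
  refine ⟨ψ.mem_sobolevH10, Submodule.subset_span ⟨?_, ?_⟩, fun ε hε =>
    ⟨gradient ψ, hmeas.measurable, ψ.contDiff.continuous_gradient.bounded_above_of_compact_support
      ψ.hasCompactSupport.gradient, ?_⟩⟩
  · exact hmeas.aestronglyMeasurable.congr ψ.weakGradient_ae_eq.symm
  · rw [orliczModular_eq_modular, modular_congr_ae ψ.weakGradient_ae_eq]
    simpa using hfin 1
  · refine lt_of_le_of_lt (b := ENNReal.ofReal (ε / 2)) (sInf_le ⟨ε / 2, by positivity, ?_, rfl⟩)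
      ((ENNReal.ofReal_lt_ofReal_iff hε).2 (by linarith))
    rw [orliczModular_eq_modular, modular_congr_ae (G := fun _ => 0)]
    · simp [modular, hφ.map_zero]
    · filter_upwards [ψ.weakGradient_ae_eq] with x hx
      simp [hx]

end

/-! ### Approximation of the truncated function -/

section

open scoped ContDiff

variable {d : ℕ} {Ω : Opens (EuclideanSpace ℝ (Fin d))}
  {Φ : EuclideanSpace ℝ (Fin d) → ℝ}

/-- Approximability in modular by gradients of test functions is stable under finite sums. -/
lemma exists_testFunction_finset_sum (hΦ : IsConvexGauge Φ) {ι : Type*}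
    {G : ι → EuclideanSpace ℝ (Fin d) → EuclideanSpace ℝ (Fin d)}
    (hG : ∀ i, AEStronglyMeasurable (G i) volume)
    (h : ∀ i (c : ℝ), ∃ ψ : 𝓓(Ω, ℝ), modular Φ volume (c • (gradient ψ - G i)) ≤ 1)
    (s : Finset ι) (c : ℝ) :
    ∃ ψ : 𝓓(Ω, ℝ), modular Φ volume (c • (gradient ψ - ∑ i ∈ s, G i)) ≤ 1 := by
  classical
  induction s using Finset.induction_on generalizing c with
  | empty =>
    refine ⟨0, ?_⟩
    have h0 : gradient (⇑(0 : 𝓓(Ω, ℝ))) = 0 := gradient_const' (F := EuclideanSpace ℝ (Fin d)) 0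
    rw [h0, Finset.sum_empty, sub_zero, smul_zero]
    simp [modular, hΦ.map_zero]
  | insert i s hi ih =>
    -- Each summand is approximated at the doubled multiple to absorb the factor from midpoint
    -- convexity.
    obtain ⟨ψ₁, h₁⟩ := h i (2 * c)
    obtain ⟨ψ₂, h₂⟩ := ih (2 * c)
    refine ⟨ψ₁ + ψ₂, ?_⟩
    have hadd : gradient (⇑(ψ₁ + ψ₂)) = gradient ψ₁ + gradient ψ₂ := by
      ext1 x
      exact ((ψ₁.contDiff.hasGradientAt x).add' (ψ₂.contDiff.hasGradientAt x)).gradient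
    rw [hadd, Finset.sum_insert hi, add_sub_add_comm, smul_add]
    rw [mul_smul] at h₁ h₂
    exact hΦ.modular_add_le_one
      ((ψ₁.contDiff.continuous_gradient.aestronglyMeasurable.sub (hG i)).const_smul c) h₁ h₂

/-- The gradient of a smoothly truncated `H¹₀` function on a Lipschitz domain is approximated by
gradients of test functions. -/
lemma exists_testFunction_arctanTrunc (hΩ : IsBoundedLipschitzDomain Ω) (hΦ : IsConvexGauge Φ)
    {w : EuclideanSpace ℝ (Fin d) → ℝ} (hw : w ∈ sobolevH10 Ω)
    (hfin : HasFiniteModulars Φ (volume.restrict (Ω : Set (EuclideanSpace ℝ (Fin d))))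
      (weakGradient Ω w)) {c : ℝ} (hc : c ≠ 0) (l : ℝ) :
    ∃ ψ : 𝓓(Ω, ℝ), modular Φ volume (l • (gradient ψ -
      (Ω : Set (EuclideanSpace ℝ (Fin d))).indicator fun x =>
        arctanTruncDeriv c (w x) • weakGradient Ω w x)) ≤ 1 := by
  have hwk := hasGlobalWeakGradient_arctanTrunc hΩ.isBounded.measure_lt_top hw hc
  set u := (Ω : Set (EuclideanSpace ℝ (Fin d))).indicator fun x => arctanTrunc c (w x) with hu
  set G := (Ω : Set (EuclideanSpace ℝ (Fin d))).indicator fun x =>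
    arctanTruncDeriv c (w x) • weakGradient Ω w x with hG
  have hGfin : HasFiniteModulars Φ volume G := fun a => by
    have h1 := hfin.bdd_smul hΦ (fun x => abs_arctanTruncDeriv_le_one c (w x)) a
    have h2 := modular_indicator hΦ.map_zero Ω.isOpen.measurableSet
      (a • fun x => arctanTruncDeriv c (w x) • weakGradient Ω w x)
    have h3 : a • G = (Ω : Set (EuclideanSpace ℝ (Fin d))).indicator
        (a • fun x => arctanTruncDeriv c (w x) • weakGradient Ω w x) :=
      (Set.indicator_const_smul (Ω : Set (EuclideanSpace ℝ (Fin d))) a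
        fun x => arctanTruncDeriv c (w x) • weakGradient Ω w x).symm
    rwa [h3, h2]
  have hub : ∀ x, |u x| ≤ |c⁻¹| * (Real.pi / 2) := fun x => by
    by_cases hx : x ∈ (Ω : Set (EuclideanSpace ℝ (Fin d)))
    · rw [hu, Set.indicator_of_mem hx]; exact abs_arctanTrunc_le c (w x)
    · rw [hu, Set.indicator_of_notMem hx, abs_zero]; positivity
  obtain ⟨s, η, hη, hηc, hsum, hshift⟩ := hΩ.exists_partitionOfUnity
  have hwki := fun i => hwk.smul_left (hη i) (hηc i)
  have hpiece : ∀ i (a : ℝ), ∃ ψ : 𝓓(Ω, ℝ),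
      modular Φ volume (a • (gradient ψ - fun x => η i x • G x + u x • gradient (η i) x)) ≤ 1 := by
    intro i a
    obtain ⟨v, t₀, ht₀, hv⟩ := hshift i
    obtain ⟨M, hM⟩ := (hη i).continuous.bounded_above_of_compact_support (hηc i)
    obtain ⟨M', hM'⟩ := (hη i).continuous_gradient.bounded_above_of_compact_support
      (hηc i).gradient
    refine (hwki i).exists_testFunction (hηc i).mul_right hΦ ?_ ht₀ (fun y hy => hv y ?_ ?_) a
    · refine HasFiniteModulars.add hΦ ?_ (hGfin.bdd_smul hΦ hM) ?_
      · exact (hη i).continuous.aestronglyMeasurable.smul hwk.integrable_grad.1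
      -- This is where the truncation pays off: `u` is bounded, hence so is `u ∇η`.
      · refine HasFiniteModulars.of_bounded (K := tsupport (gradient (η i))) hΦ
          (hηc i).gradient.isCompact.measure_lt_top (fun x hx => ?_) (C := |c⁻¹| * (Real.pi / 2) * M')
          fun x => ?_
        · rw [image_eq_zero_of_notMem_tsupport hx, smul_zero]
        · rw [norm_smul]
          exact mul_le_mul (hub x) (hM' x) (norm_nonneg _) (by positivity)
    · refine closure_mono (fun x hx => ?_) (tsupport_mul_subset_right hy)
      by_contra hxΩ
      exact hx (Set.indicator_of_notMem hxΩ _)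
    · exact tsupport_mul_subset_left hy
  obtain ⟨ψ, hψ⟩ := exists_testFunction_finset_sum hΦ (fun i => (hwki i).integrable_grad.1) hpiece
    Finset.univ l
  refine ⟨ψ, ?_⟩
  convert hψ using 4
  ext1 x
  rw [Finset.sum_apply, Finset.sum_add_distrib, ← Finset.sum_smul, ← Finset.smul_sum]
  by_cases hx : x ∈ (Ω : Set (EuclideanSpace ℝ (Fin d)))
  -- The sum of the cutoffs is constant near `x` because `Ω` is open. Outside `Ω` both `u` and `G`
  -- vanish.
  · have hgrad : ∑ i, gradient (η i) x = 0 := by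
      have h1 : HasGradientAt (fun y => ∑ i, η i y) (∑ i, gradient (η i) x) x := by
        rw [hasGradientAt_iff_hasFDerivAt, map_sum]
        exact HasFDerivAt.fun_sum fun i _ => ((hη i).hasGradientAt x).hasFDerivAt
      have h2 : (fun y => ∑ i, η i y) =ᶠ[𝓝 x] fun _ => 1 :=
        by
        filter_upwards [Ω.isOpen.mem_nhds hx] with y hy using hsum y (subset_closure hy)
      exact h1.unique ((hasGradientAt_const x 1).congr_of_eventuallyEq h2)
    rw [hgrad, hsum x (subset_closure hx), one_smul, smul_zero, add_zero]
  · rw [hu, hG, Set.indicator_of_notMem hx, Set.indicator_of_notMem hx, smul_zero, zero_smul,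
      add_zero]

/-- The gradients of the smooth truncations converge in modular. -/
lemma exists_arctanTrunc_modular_le (hΦ : IsConvexGauge Φ) {X : Type*} [MeasurableSpace X]
    {μ : Measure X} {w : X → ℝ} {G : X → EuclideanSpace ℝ (Fin d)} (hw : AEStronglyMeasurable w μ)
    (hG : AEStronglyMeasurable G μ) (hfin : HasFiniteModulars Φ μ G) (l : ℝ) :
    ∃ c ≠ 0, modular Φ μ (l • fun x => arctanTruncDeriv c (w x) • G x - G x) ≤ 1 := by
  have hlim0 : Tendsto (fun n : ℕ => 1 / ((n : ℝ) + 1)) atTop (𝓝 0) :=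
    tendsto_one_div_add_atTop_nhds_zero_nat
  have hlim : Tendsto (fun n : ℕ => modular Φ μ
      (l • fun x => arctanTruncDeriv (1 / ((n : ℝ) + 1)) (w x) • G x - G x)) atTop
      (𝓝 (∫⁻ _, 0 ∂μ)) := by
    -- Since `|T' - 1| ≤ 1`, the gauge of `l • G` dominates.
    refine tendsto_lintegral_of_dominated_convergence'
      (fun x => ENNReal.ofReal (Φ (l • G x))) (fun n => ?_) (fun n => .of_forall fun x => ?_)
      (hfin l).ne (.of_forall fun x => ?_)
    · exact hΦ.aemeasurable_comp (((((continuous_arctanTruncDeriv _).comp_aestronglyMeasurable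
        hw).smul hG).sub hG).const_smul l)
    · refine ENNReal.ofReal_le_ofReal ?_
      have h1 := arctanTruncDeriv_pos (1 / ((n : ℝ) + 1)) (w x)
      have h2 := arctanTruncDeriv_le_one (1 / ((n : ℝ) + 1)) (w x)
      have h3 : (l • fun x => arctanTruncDeriv (1 / ((n : ℝ) + 1)) (w x) • G x - G x) x =
          (arctanTruncDeriv (1 / ((n : ℝ) + 1)) (w x) - 1) • l • G x := by
        rw [Pi.smul_apply, sub_smul, one_smul, smul_sub, smul_comm]
      rw [h3]
      exact hΦ.map_smul_le (abs_le.2 ⟨by linarith, by linarith⟩) _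
    · have h1 := (((tendsto_arctanTruncDeriv (w x)).comp hlim0).smul_const (G x)).sub_const (G x)
      have h2 := h1.const_smul l
      rw [one_smul, sub_self, smul_zero] at h2
      have h3 := ENNReal.tendsto_ofReal ((hΦ.continuous.tendsto 0).comp h2)
      rw [hΦ.map_zero, ENNReal.ofReal_zero] at h3
      exact h3
  rw [lintegral_zero] at hlim
  obtain ⟨n, hn⟩ := (hlim.eventually_le_const one_pos).exists
  exact ⟨1 / ((n : ℝ) + 1), by positivity, hn⟩

end

/-! ### Density of test functions in `V` -/

theorem mainTheorem7 {d : ℕ} (φ : EuclideanSpace ℝ (Fin d) → ℝ) (hφ : IsNFunction φ)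
    (Ω : Opens (EuclideanSpace ℝ (Fin d))) (hΩ : IsBoundedLipschitzDomain Ω) :
    (∀ ψ : 𝓓(Ω, ℝ), ⇑ψ ∈ spaceV φ Ω) ∧
      ∀ w ∈ spaceV φ Ω, ∀ ε : ℝ, 0 < ε →
        ∃ ψ : 𝓓(Ω, ℝ), normV φ Ω (w - ⇑ψ) < ENNReal.ofReal ε := by
  have hg := hφ.isConvexGauge
  have hΦ := hg.add_norm_sq
  refine ⟨fun ψ => ψ.mem_spaceV hg, fun w hw ε hε => ?_⟩
  obtain ⟨hw0, hwE⟩ := hw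
  set μ := volume.restrict (Ω : Set (EuclideanSpace ℝ (Fin d))) with hμ
  set G := weakGradient Ω w with hG
  have hG2 : MemLp G 2 μ := hw0.1.2.2
  have hfin : HasFiniteModulars (fun ξ => φ ξ + ‖ξ‖ ^ 2) μ G := fun a => by
    rw [modular_add_norm_sq hg (hG2.1.const_smul a)]
    exact ENNReal.add_lt_top.2
      ⟨hasFiniteModulars_of_mem_orliczE hg hΩ.isBounded.measure_lt_top hwE a,
        ENNReal.pow_lt_top (hG2.const_smul a).2⟩
  -- The norm of `V` will be at most `2 * l = ε / 2`; both errors are taken at the multiple `2 *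
  -- l⁻¹` so that their sum has modular at most `1` at `l⁻¹`.
  set l : ℝ := ε / 4 with hl
  have hl0 : 0 < l := by positivity
  obtain ⟨c, hc, hcm⟩ := exists_arctanTrunc_modular_le hΦ hw0.1.1.1 hG2.1 hfin (2 * l⁻¹)
  obtain ⟨ψ, hψ⟩ := exists_testFunction_arctanTrunc hΩ hΦ hw0 hfin hc (2 * l⁻¹)
  have hsub := weakGradient_sub_testFunction_ae_eq hw0.1.2.1 ψ
  have hGm : AEStronglyMeasurable (weakGradient Ω (w - ⇑ψ)) μ :=
    (hG2.1.sub ψ.contDiff.continuous_gradient.aestronglyMeasurable).congr hsub.symm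
  refine ⟨ψ, (normV_le_of_modular_le hg hl0 hGm ?_).trans_lt
    ((ENNReal.ofReal_lt_ofReal_iff hε).2 (by rw [hl]; linarith))⟩
  set T : EuclideanSpace ℝ (Fin d) → EuclideanSpace ℝ (Fin d) :=
    fun x => arctanTruncDeriv c (w x) • G x with hT
  have hTm : AEStronglyMeasurable T μ :=
    ((continuous_arctanTruncDeriv c).comp_aestronglyMeasurable hw0.1.1.1).smul hG2.1
  have hψ' : modular (fun ξ => φ ξ + ‖ξ‖ ^ 2) μ ((2 * l⁻¹) • (gradient ψ - T)) ≤ 1 := by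
    have hind : (2 * l⁻¹) • (gradient ψ - T) =ᵐ[μ] (2 * l⁻¹) • (gradient ψ -
        (Ω : Set (EuclideanSpace ℝ (Fin d))).indicator T) := by
      filter_upwards [ae_restrict_mem Ω.isOpen.measurableSet] with x hx
      simp [Set.indicator_of_mem hx]
    rw [modular_congr_ae hind]
    exact (lintegral_mono' Measure.restrict_le_self le_rfl).trans hψ
  have hsplit : l⁻¹ • weakGradient Ω (w - ⇑ψ) =ᵐ[μ]
      (-l⁻¹) • (gradient ψ - T) + (-l⁻¹) • fun x => T x - G x := by
    filter_upwards [hsub] with x hx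
    simp only [Pi.smul_apply, Pi.add_apply, Pi.sub_apply, hx]
    rw [← smul_add, sub_add_sub_cancel, neg_smul, ← smul_neg, neg_sub]
  rw [modular_congr_ae hsplit]
  have habs : |2 * -l⁻¹| ≤ |2 * l⁻¹| := by rw [mul_neg, abs_neg]
  refine hΦ.modular_add_le_one
    ((ψ.contDiff.continuous_gradient.aestronglyMeasurable.sub hTm).const_smul _) ?_ ?_
  · rw [smul_smul]
    exact (hΦ.modular_smul_le habs _).trans hψ'
  · rw [smul_smul]
    exact (hΦ.modular_smul_le habs _).trans hcm
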